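/- Let $\delta\ge 1$, $\eta,\mu,k_4>0$ with $\delta\ge\eta\mu$, and let $k_1,k_2,k_3:\mathbb R\to(0,\infty)$ be Lipschitz continuous and strictly increasing. For $s\ge 0$ consider, on the state space $\mathbb R_{\ge0}^3$, the system $$\dot u_1=-k_1(u_2)u_1-\delta k_3(u_3)u_2u_1^\delta+\eta k_4u_2+s,\qquad \dot u_2=\mu k_3(u_3)u_2u_1^\delta-k_4u_2,\qquad \dot u_3=-k_2(u_2)u_3 .$$ Put $U_1=\big(k_4/(\mu k_3(0))\big)^{1/\delta}$ and consider the equation $$0=-k_1(v)U_1-\tfrac{k_4}{\mu}(\delta-\eta\mu)v+s.\qquad(*)$$ If $\delta=\eta\mu$, assume in addition that $(*)$ has a solution $v\in\mathbb R$ for every $s\ge k_1(0)U_1$. Write $u_e^1=(s/k_1(0),0,0)$ and $\lambda(s)=\mu k_3(0)(s/k_1(0))^\delta-k_4$. Asymptotic stability and instability are meant in the sense of Lyapunov. Then: 1. The value $s=k_1(0)U_1$ is a bifurcation point: arbitrarily close to it there are values $s\ge0$ for which the system on $\mathbb R_{\ge0}^3$ is not topologically equivalent to the system at $s=k_1(0)U_1$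 (no homeomorphism of $\mathbb R_{\ge0}^3$ takes forward orbits onto forward orbits). 2. If $0\le s\le k_1(0)U_1$, then $u_e^1$ is the only equilibrium in $\mathbb R_{\ge0}^3$. If $s>k_1(0)U_1$, then $(*)$ has exactly one real solution $u_2^*$, it is positive, and there are exactly two equilibria in $\mathbb R_{\ge0}^3$, namely $u_e^1$ and $u_e^2=(U_1,u_2^*,0)$. 3. If $0\le s<k_1(0)U_1$, then $\lambda(s)<0$ and $u_e^1$ is asymptotically stable with respect to initial data in $\mathbb R_{\ge 0}^3$, and for $s>0$ also with respect to all initial data in $\mathbb R^3$. If $s>k_1(0)U_1$, then $\lambda(s)>0$ and $u_e^1$ is unstable, already with respect to initial data in $\mathbb R_{\ge0}^3$. If $k_1$ is differentiable at $0$, the right-hand side is differentiable at $u_e^1$ with Jacobian $$\begin{bmatrix}-k_1(0)&-\frac{k_1'(0)}{k_1(0)}s-\delta k_3(0)\big(\frac{s}{k_1(0)}\big)^\delta+\eta k_4&0\\0&\lambda(s)&0\\0&0&-k_2(0)\end{bmatrix},$$ whose eigenvalues, with multiplicity, are $-k_1(0),\lambda(s),-k_2(0)$. 4. If $s>k_1(0)U_1$,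 then $u_e^2$ is asymptotically stable, both with respect to initial data in $\mathbb R_{\ge0}^3$ and with respect to all initial data in $\mathbb R^3$. If moreover $k_1$ is differentiable at $u_2^*$ and $k_3$ at $0$, the right-hand side is differentiable at $u_e^2$ with Jacobian $$\begin{bmatrix}A_1&A_2&-\frac\delta\mu\frac{k_3'(0)}{k_3(0)}k_4u_2^*\\A_3&0&\frac{k_3'(0)}{k_3(0)}k_4u_2^*\\0&0&-k_2(u_2^*)\end{bmatrix},\qquad \begin{aligned}A_1&=-k_1(u_2^*)-\delta^2k_3(0)u_2^*U_1^{\delta-1},\\A_2&=-k_1'(u_2^*)U_1-\tfrac{k_4}\mu(\delta-\eta\mu),\\A_3&=\delta\mu k_3(0)u_2^*U_1^{\delta-1},\end{aligned}$$ whose eigenvalues, with multiplicity, are $-k_2(u_2^*)$ and $\frac{A_1}2\pm\sqrt{\frac{A_1^2}4+A_2A_3}$; all of them have negative real part if $\delta>\eta\mu$ or $k_1'(u_2^*)\ne0$. 5. For every $s\ge0$ exactly one equilibrium in $\mathbb R_{\ge0}^3$ is Lyapunov stable with respect to initial data in $\mathbb R_{\ge0}^3$. -/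

import Mathlib

open Set Filter Topology

noncomputable section

/-! ### Autonomous differential equations on a state space

The state space is a subset `S` of `ℝⁿ`, realised as `Fin n → ℝ`. All notions below depend on the
metric only through the topology, so the choice of norm on `ℝⁿ` is immaterial. -/

/-- `u` is a classical solution of `u' = f(u)` on the time interval `I`, with values in `S`. -/
def IsSolutionOn {n : ℕ} (f : (Fin n → ℝ) → (Fin n → ℝ)) (S : Set (Fin n → ℝ)) (I : Set ℝ)
    (u : ℝ → (Fin n → ℝ)) : Prop :=
  ∀ t ∈ I, u t ∈ S ∧ HasDerivWithinAt u (f (u t)) I t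

/-- The equilibrium points of `u' = f(u)` in `S`. -/
def equilibria {n : ℕ} (f : (Fin n → ℝ) → (Fin n → ℝ)) (S : Set (Fin n → ℝ)) :
    Set (Fin n → ℝ) :=
  {e | e ∈ S ∧ f e = 0}

/-- Lyapunov stability of `e` relative to the state space `S`: for initial data in `S` close to
`e`, a solution in `S` exists for all times, and all solutions stay close to `e`. -/
def LyapunovStable {n : ℕ} (f : (Fin n → ℝ) → (Fin n → ℝ)) (S : Set (Fin n → ℝ))
    (e : Fin n → ℝ) : Prop :=
  ∀ ε > 0, ∃ r > 0, ∀ x ∈ S, dist x e < r →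
    (∃ u, IsSolutionOn f S (Ici 0) u ∧ u 0 = x) ∧
    ∀ T ≥ 0, ∀ u, IsSolutionOn f S (Icc 0 T) u → u 0 = x → ∀ t ∈ Icc 0 T, dist (u t) e < ε

/-- Asymptotic stability of `e` relative to `S`: Lyapunov stability, and all solutions that start
close enough to `e` converge to `e`. -/
def AsymptoticallyStable {n : ℕ} (f : (Fin n → ℝ) → (Fin n → ℝ)) (S : Set (Fin n → ℝ))
    (e : Fin n → ℝ) : Prop :=
  LyapunovStable f S e ∧
  ∃ r > 0, ∀ u, IsSolutionOn f S (Ici 0) u → dist (u 0) e < r → Tendsto u atTop (𝓝 e)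

/-- Instability of `e` relative to `S`: arbitrarily close to `e` there start solutions in `S` that
reach a fixed distance from `e`. (Instability relative to `S` implies instability relative to every
larger state space.) -/
def Unstable {n : ℕ} (f : (Fin n → ℝ) → (Fin n → ℝ)) (S : Set (Fin n → ℝ))
    (e : Fin n → ℝ) : Prop :=
  ∃ ε > 0, ∀ r > 0, ∃ T ≥ 0, ∃ u, IsSolutionOn f S (Icc 0 T) u ∧ dist (u 0) e < r ∧
    ε ≤ dist (u T) e

/-- The set of states that are reached, forwards in time, from the state `x`. -/
def positiveOrbit {n : ℕ} (f : (Fin n → ℝ) → (Fin n → ℝ)) (S : Set (Fin n → ℝ))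
    (x : Fin n → ℝ) : Set (Fin n → ℝ) :=
  {y | ∃ T ≥ 0, ∃ u, IsSolutionOn f S (Icc 0 T) u ∧ u 0 = x ∧ u T = y}

/-- Topological equivalence of `u' = f(u)` and `u' = g(u)` on `S`: a homeomorphism of `S` takes
the (forward) orbits of `f` onto the (forward) orbits of `g`. -/
def TopologicallyEquivalent {n : ℕ} (f g : (Fin n → ℝ) → (Fin n → ℝ))
    (S : Set (Fin n → ℝ)) : Prop :=
  ∃ h : S ≃ₜ S, ∀ x y : S, (y : Fin n → ℝ) ∈ positiveOrbit f S x ↔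
    (h y : Fin n → ℝ) ∈ positiveOrbit g S (h x)

/-- `s₀` is a bifurcation point of the family `u' = F s u` on `S`, with parameter `s` in `A`:
arbitrarily close to `s₀` there are parameters in `A` at which the system is not topologically
equivalent to the one at `s₀`. -/
def IsBifurcationPoint {n : ℕ} (F : ℝ → (Fin n → ℝ) → (Fin n → ℝ)) (S : Set (Fin n → ℝ))
    (A : Set ℝ) (s₀ : ℝ) : Prop :=
  s₀ ∈ A ∧ ∃ᶠ s in 𝓝[A] s₀, ¬ TopologicallyEquivalent (F s) (F s₀) S

/-- The Jacobian matrix of `f` at `x` (meaningful where `f` is differentiable). -/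
def jacobian {n : ℕ} (f : (Fin n → ℝ) → (Fin n → ℝ)) (x : Fin n → ℝ) :
    Matrix (Fin n) (Fin n) ℝ :=
  LinearMap.toMatrix' (fderiv ℝ f x : (Fin n → ℝ) →ₗ[ℝ] (Fin n → ℝ))

/-- The complex eigenvalues of a real matrix, with algebraic multiplicity. -/
def complexEigenvalues {n : ℕ} (M : Matrix (Fin n) (Fin n) ℝ) : Multiset ℂ :=
  (M.map (algebraMap ℝ ℂ)).charpoly.roots

/-- The nonnegative octant. -/
def octant : Set (Fin 3 → ℝ) := {u | ∀ i, 0 ≤ u i}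

/-! ### The soil model -/

/-- The parameters and constitutive functions of the model. -/
structure SoilModel where
  δ : ℝ
  η : ℝ
  μ : ℝ
  k₄ : ℝ
  k₁ : ℝ → ℝ
  k₂ : ℝ → ℝ
  k₃ : ℝ → ℝ

namespace SoilModel

/-- The right-hand side of the reduced system for
`(u₁, u₂, u₃)` = (organic matter, microbes, charcoal), with source `s`. -/
def field (P : SoilModel) (s : ℝ) (u : Fin 3 → ℝ) : Fin 3 → ℝ :=
  ![-P.k₁ (u 1) * u 0 - P.δ * P.k₃ (u 2) * u 1 * u 0 ^ P.δ + P.η * P.k₄ * u 1 + s,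
    P.μ * P.k₃ (u 2) * u 1 * u 0 ^ P.δ - P.k₄ * u 1,
    -P.k₂ (u 1) * u 2]

def U₁ (P : SoilModel) : ℝ := (P.k₄ / (P.μ * P.k₃ 0)) ^ (1 / P.δ)

/-- The critical value `k₁(0) U₁` of the source. -/
def threshold (P : SoilModel) : ℝ := P.k₁ 0 * P.U₁

/-- The scalar equation for the second component `v` of an equilibrium `(U₁, v, 0)`. -/
def MicrobeEq (P : SoilModel) (s v : ℝ) : Prop :=
  0 = -P.k₁ v * P.U₁ - P.k₄ / P.μ * (P.δ - P.η * P.μ) * v + s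

/-- The standing assumptions. The last one is only needed in the balanced case `δ = ημ`; for
`δ > ημ` the equation is always solvable. -/
structure Admissible (P : SoilModel) : Prop where
  one_le_δ : 1 ≤ P.δ
  η_pos : 0 < P.η
  μ_pos : 0 < P.μ
  ημ_le_δ : P.η * P.μ ≤ P.δ
  k₄_pos : 0 < P.k₄
  k₁_pos : ∀ x, 0 < P.k₁ x
  k₂_pos : ∀ x, 0 < P.k₂ x
  k₃_pos : ∀ x, 0 < P.k₃ x
  k₁_lipschitz : ∃ K, LipschitzWith K P.k₁
  k₂_lipschitz : ∃ K, LipschitzWith K P.k₂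
  k₃_lipschitz : ∃ K, LipschitzWith K P.k₃
  k₁_strictMono : StrictMono P.k₁
  k₂_strictMono : StrictMono P.k₂
  k₃_strictMono : StrictMono P.k₃
  solvable : P.δ = P.η * P.μ → ∀ s, P.threshold ≤ s → ∃ v, P.MicrobeEq s v

/-- The equilibrium without microbes. -/
def e₁ (P : SoilModel) (s : ℝ) : Fin 3 → ℝ := ![s / P.k₁ 0, 0, 0]

/-- The equilibrium with microbe concentration `v`. -/
def e₂ (P : SoilModel) (v : ℝ) : Fin 3 → ℝ := ![P.U₁, v, 0]

/-- The eigenvalue of the linearization at `e₁` that changes sign. -/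
def criticalEigenvalue (P : SoilModel) (s : ℝ) : ℝ :=
  P.μ * P.k₃ 0 * (s / P.k₁ 0) ^ P.δ - P.k₄

def A₁ (P : SoilModel) (v : ℝ) : ℝ := -P.k₁ v - P.δ ^ 2 * P.k₃ 0 * v * P.U₁ ^ (P.δ - 1)

def A₂ (P : SoilModel) (v : ℝ) : ℝ :=
  -deriv P.k₁ v * P.U₁ - P.k₄ / P.μ * (P.δ - P.η * P.μ)

def A₃ (P : SoilModel) (v : ℝ) : ℝ := P.δ * P.μ * P.k₃ 0 * v * P.U₁ ^ (P.δ - 1)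

/-- The principal complex square root of `A₁² / 4 + A₂ A₃`. -/
def sqrtDiscr (P : SoilModel) (v : ℝ) : ℂ :=
  ((P.A₁ v ^ 2 / 4 + P.A₂ v * P.A₃ v : ℝ) : ℂ) ^ (1 / 2 : ℂ)

end SoilModel

end

noncomputable section

/-! ### Solutions of autonomous differential equations -/

section ODE

variable {n : ℕ} {f : (Fin n → ℝ) → (Fin n → ℝ)} {S : Set (Fin n → ℝ)}

/-! The charcoal equation forces `u 2 = 0` at an equilibrium, and the microbe equation then leaves
`u 1 = 0` or `u 0 = U₁`. In the second case the first equation says that the strictly decreasing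
function `surplus` vanishes, and `surplus` at `0` equals `s - threshold`; this gives the equilibria.
Forward uniqueness and global existence in the octant identify equilibria with one-point forward
orbits, which a topological equivalence preserves, so the jump from one equilibrium to two is a
bifurcation.

The rate functions are only Lipschitz, hence stability comes from differential inequalities and not
from linearization. Below the threshold a weighted sum of squares decays exponentially near `e₁`
(`exists_lyapunov_e₁`). Above it a small population of microbes grows exponentially (`unstable_e₁`).
At the threshold the growth rate of the microbes in the octant is bounded by an integrable
exponential, so they grow at most by a fixed factor (`stableWithin_e₁_threshold`).

At `e₂` the sum of a potential in `u 0` and one in `u 1` is a Lyapunov function: the mixed terms of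
its derivative cancel. What remains controls only `(u 0 - U₁) ^ 2`, up to an error from the
exponentially decaying charcoal (`exists_lyapunovDeriv_le`). This yields stability. For attraction,
the product `(u 0 - U₁) * (u 1 - v)` is added to a large multiple of the Lyapunov function; its
derivative supplies the missing dissipation in `u 1` (`exists_cross_le`,
`exists_dist_lt_or_charcoal`).

Stability is first shown for solutions confined to a ball (`StableWithin`); a first-exit argument
removes the confinement. -/

theorem IsSolutionOn.mono {I J : Set ℝ} {u : ℝ → Fin n → ℝ} (h : IsSolutionOn f S I u)
    (hJ : J ⊆ I) : IsSolutionOn f S J u :=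
  fun t ht => ⟨(h t (hJ ht)).1, (h t (hJ ht)).2.mono hJ⟩

theorem IsSolutionOn.univ {I : Set ℝ} {u : ℝ → Fin n → ℝ} (h : IsSolutionOn f S I u) :
    IsSolutionOn f Set.univ I u :=
  fun t ht => ⟨mem_univ _, (h t ht).2⟩

theorem IsSolutionOn.continuousOn {I : Set ℝ} {u : ℝ → Fin n → ℝ} (h : IsSolutionOn f S I u) :
    ContinuousOn u I :=
  fun t ht => (h t ht).2.continuousWithinAt

theorem IsSolutionOn.hasDerivWithinAt_apply {I : Set ℝ} {u : ℝ → Fin n → ℝ}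
    (h : IsSolutionOn f S I u) {t : ℝ} (ht : t ∈ I) (i : Fin n) :
    HasDerivWithinAt (fun t => u t i) (f (u t) i) I t :=
  hasDerivWithinAt_pi.1 (h t ht).2 i

theorem IsSolutionOn.shift {u : ℝ → Fin n → ℝ} (h : IsSolutionOn f S (Ici 0) u) {a : ℝ}
    (ha : 0 ≤ a) : IsSolutionOn f S (Ici 0) (fun t => u (a + t)) := by
  intro t ht
  have hm : a + t ∈ Ici (0 : ℝ) := add_nonneg ha ht
  refine ⟨(h _ hm).1, ?_⟩
  have h1 : HasDerivWithinAt (fun t : ℝ => a + t) 1 (Ici 0) t :=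
    (hasDerivWithinAt_id t _).const_add a
  have h2 := (h _ hm).2.scomp t h1 (fun x hx => add_nonneg ha hx)
  rw [one_smul] at h2
  exact h2

/-- On bounded parts of the state space the field is Lipschitz. -/
def LipschitzOnBounded (f : (Fin n → ℝ) → (Fin n → ℝ)) (S : Set (Fin n → ℝ)) : Prop :=
  ∀ R : ℝ, ∃ K, LipschitzOnWith K f (S ∩ Metric.closedBall 0 R)

theorem IsSolutionOn.hasDerivWithinAt_Ici {T : ℝ} {u : ℝ → Fin n → ℝ}
    (h : IsSolutionOn f S (Icc 0 T) u) {t : ℝ} (ht : t ∈ Ico 0 T) :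
    HasDerivWithinAt u (f (u t)) (Ici t) t :=
  (h t ⟨ht.1, ht.2.le⟩).2.mono_of_mem_nhdsWithin <|
    mem_of_superset (Icc_mem_nhdsGE ht.2) (Icc_subset_Icc_left ht.1)

theorem LipschitzOnBounded.eqOn (hf : LipschitzOnBounded f S) {T : ℝ}
    {u w : ℝ → Fin n → ℝ} (hu : IsSolutionOn f S (Icc 0 T) u) (hw : IsSolutionOn f S (Icc 0 T) w)
    (h0 : u 0 = w 0) : EqOn u w (Icc 0 T) := by
  obtain ⟨R₁, hR₁⟩ := (isCompact_Icc.image_of_continuousOn hu.continuousOn).isBounded.subset_closedBall 0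
  obtain ⟨R₂, hR₂⟩ := (isCompact_Icc.image_of_continuousOn hw.continuousOn).isBounded.subset_closedBall 0
  obtain ⟨K, hK⟩ := hf (max R₁ R₂)
  refine ODE_solution_unique_of_mem_Icc_right (v := fun _ => f)
    (s := fun _ => S ∩ Metric.closedBall 0 (max R₁ R₂)) (fun _ _ => hK)
    hu.continuousOn (fun t ht => hu.hasDerivWithinAt_Ici ht) ?_
    hw.continuousOn (fun t ht => hw.hasDerivWithinAt_Ici ht) ?_ h0
  · exact fun t ht => ⟨(hu t ⟨ht.1, ht.2.le⟩).1, Metric.closedBall_subset_closedBall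
      (le_max_left _ _) (hR₁ (mem_image_of_mem _ ⟨ht.1, ht.2.le⟩))⟩
  · exact fun t ht => ⟨(hw t ⟨ht.1, ht.2.le⟩).1, Metric.closedBall_subset_closedBall
      (le_max_right _ _) (hR₂ (mem_image_of_mem _ ⟨ht.1, ht.2.le⟩))⟩

/-- Solutions on all compact time intervals glue to a global one. -/
theorem LipschitzOnBounded.exists_Ici (hf : LipschitzOnBounded f S) {x : Fin n → ℝ}
    (h : ∀ T : ℝ, 0 ≤ T → ∃ u, IsSolutionOn f S (Icc 0 T) u ∧ u 0 = x) :
    ∃ u, IsSolutionOn f S (Ici 0) u ∧ u 0 = x := by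
  choose U hU hU0 using fun m : ℕ => h m m.cast_nonneg
  have key : ∀ N : ℕ, ∀ t : ℝ, 0 ≤ t → t < N → U (⌊t⌋₊ + 1) t = U N t := by
    intro N t ht htN
    have hle : ⌊t⌋₊ + 1 ≤ N := Nat.succ_le_of_lt ((Nat.floor_lt ht).2 htN)
    have hle' : (((⌊t⌋₊ + 1 : ℕ) : ℝ)) ≤ (N : ℝ) := by exact_mod_cast hle
    refine hf.eqOn (hU _) ((hU N).mono (Icc_subset_Icc_right hle')) (by rw [hU0, hU0]) ⟨ht, ?_⟩
    push_cast
    exact (Nat.lt_floor_add_one t).le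
  refine ⟨fun t => U (⌊t⌋₊ + 1) t, fun t ht => ?_, by simp [hU0]⟩
  have ht0 : (0 : ℝ) ≤ t := ht
  -- The extra unit of time leaves room to the right of `t`, so the derivative within `Icc` is one
  -- within `Ici 0`.
  have htN : t < ((⌊t⌋₊ + 2 : ℕ) : ℝ) := by
    push_cast
    linarith [Nat.lt_floor_add_one t]
  have hs := hU (⌊t⌋₊ + 2) t ⟨ht0, htN.le⟩
  have he := key (⌊t⌋₊ + 2) t ht0 htN
  refine ⟨by simpa only [he] using hs.1, ?_⟩
  simp only [he]
  have hmem : Icc 0 (((⌊t⌋₊ + 2 : ℕ) : ℝ)) ∈ 𝓝[Ici 0] t := by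
    filter_upwards [self_mem_nhdsWithin, mem_nhdsWithin_of_mem_nhds (Iio_mem_nhds htN)] with y h1 h2
      using ⟨h1, le_of_lt h2⟩
  refine (hs.2.mono_of_mem_nhdsWithin hmem).congr_of_eventuallyEq ?_ he
  filter_upwards [self_mem_nhdsWithin, mem_nhdsWithin_of_mem_nhds (Iio_mem_nhds htN)] with y h1 h2
    using key _ y h1 h2

/-- The coordinatewise projection onto the box `Icc a b`. -/
def clamp (a b u : Fin n → ℝ) : Fin n → ℝ := fun i => max (a i) (min (b i) (u i))

theorem clamp_mem {a b : Fin n → ℝ} (hab : a ≤ b) (u : Fin n → ℝ) : clamp a b u ∈ Icc a b :=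
  ⟨fun _ => le_max_left _ _, fun i => max_le (hab i) (min_le_left _ _)⟩

theorem clamp_of_mem {a b u : Fin n → ℝ} (hu : u ∈ Icc a b) : clamp a b u = u := by
  ext i
  simp only [clamp]
  rw [min_eq_right (hu.2 i), max_eq_right (hu.1 i)]

theorem lipschitzWith_clamp (a b : Fin n → ℝ) : LipschitzWith 1 (clamp a b) := by
  refine LipschitzWith.of_dist_le_mul fun u w => ?_
  rw [NNReal.coe_one, one_mul]
  refine (dist_pi_le_iff dist_nonneg).2 fun i => le_trans ?_ (dist_le_pi_dist u w i)
  rw [Real.dist_eq, Real.dist_eq]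
  simp only [clamp]
  calc _ ≤ |min (b i) (u i) - min (b i) (w i)| := by
        simpa [max_comm] using abs_max_sub_max_le_abs (min (b i) (u i)) (min (b i) (w i)) (a i)
    _ ≤ _ := by simpa using abs_min_sub_min_le_max (b i) (u i) (b i) (w i)

/-- A field that is Lipschitz on a box, frozen outside the box, has global solutions. -/
theorem exists_solution_clamp {a b : Fin n → ℝ} (hab : a ≤ b) {K : NNReal}
    (hf : LipschitzOnWith K f (Icc a b)) (x : Fin n → ℝ) :
    ∃ u, IsSolutionOn (fun w => f (clamp a b w)) univ (Ici 0) u ∧ u 0 = x := by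
  have hlip : LipschitzWith K (fun w => f (clamp a b w)) := by
    refine LipschitzWith.of_dist_le_mul fun u w => ?_
    refine (hf.dist_le_mul _ (clamp_mem hab u) _ (clamp_mem hab w)).trans ?_
    gcongr
    simpa using (lipschitzWith_clamp a b).dist_le_mul u w
  obtain ⟨M, hM⟩ : ∃ M : NNReal, ∀ w, ‖f (clamp a b w)‖ ≤ M := by
    obtain ⟨R, hR⟩ := (isCompact_Icc.image_of_continuousOn hf.continuousOn).isBounded.subset_closedBall 0
    refine ⟨R.toNNReal, fun w => ?_⟩
    have := hR (mem_image_of_mem f (clamp_mem hab w))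
    rw [mem_closedBall_zero_iff] at this
    exact this.trans (Real.le_coe_toNNReal R)
  refine LipschitzOnBounded.exists_Ici (fun R => ⟨K, hlip.lipschitzOnWith⟩) fun T hT => ?_
  -- A field bounded by `M` moves a point by at most `M * T` in time `T`, so one Picard–Lindelöf
  -- step covers the whole interval.
  have hpl : IsPicardLindelof (fun _ w => f (clamp a b w)) (tmin := 0) (tmax := T)
      ⟨0, le_rfl, hT⟩ x (M * T.toNNReal) 0 M K := by
    refine IsPicardLindelof.of_time_independent (fun w _ => hM w) hlip.lipschitzOnWith ?_
    simp [hT]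
  obtain ⟨u, hu0, hu⟩ := hpl.exists_eq_forall_mem_Icc_hasDerivWithinAt₀
  exact ⟨u, fun t ht => ⟨mem_univ _, hu t ht⟩, hu0⟩

end ODE

/-! ### Differential inequalities -/

theorem antitoneOn_Icc_of_hasDerivWithinAt {φ φ' : ℝ → ℝ} {a b : ℝ}
    (h : ∀ t ∈ Icc a b, HasDerivWithinAt φ (φ' t) (Icc a b) t) (h' : ∀ t ∈ Ioo a b, φ' t ≤ 0) :
    AntitoneOn φ (Icc a b) := by
  refine antitoneOn_of_hasDerivWithinAt_nonpos (convex_Icc a b)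
    (fun t ht => (h t ht).continuousWithinAt) (f' := φ') ?_ ?_
  · exact fun t ht => (h t (interior_subset ht)).mono interior_subset
  · rwa [interior_Icc]

/-- A function that decreases wherever it exceeds `c` cannot rise above `c`. -/
theorem le_of_hasDerivWithinAt_nonpos_above {φ φ' : ℝ → ℝ} {T c : ℝ}
    (h : ∀ t ∈ Icc 0 T, HasDerivWithinAt φ (φ' t) (Icc 0 T) t)
    (h' : ∀ t ∈ Icc 0 T, c < φ t → φ' t ≤ 0) (h0 : φ 0 ≤ c) :
    ∀ t ∈ Icc 0 T, φ t ≤ c := by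
  intro t ht
  by_contra! hlt
  have hcont : ContinuousOn φ (Icc 0 T) := fun t ht => (h t ht).continuousWithinAt
  have hclosed : IsClosed {τ ∈ Icc 0 t | φ τ ≤ c} :=
    (hcont.mono (Icc_subset_Icc_right ht.2)).preimage_isClosed_of_isClosed isClosed_Icc isClosed_Iic
  have hne : {τ ∈ Icc 0 t | φ τ ≤ c}.Nonempty := ⟨0, ⟨le_rfl, ht.1⟩, h0⟩
  have hbdd : BddAbove {τ ∈ Icc 0 t | φ τ ≤ c} := ⟨t, fun τ hτ => hτ.1.2⟩
  -- The last time before `t` at which `φ ≤ c`. Beyond it `φ` exceeds `c` and hence decreases, a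
  -- contradiction.
  set τ := sSup {τ ∈ Icc 0 t | φ τ ≤ c}
  have hτ : τ ∈ {τ ∈ Icc 0 t | φ τ ≤ c} := hclosed.csSup_mem hne hbdd
  have hsub : Icc τ t ⊆ Icc 0 T := Icc_subset_Icc hτ.1.1 ht.2
  have hanti : AntitoneOn φ (Icc τ t) := by
    refine antitoneOn_Icc_of_hasDerivWithinAt (fun σ hσ => (h σ (hsub hσ)).mono hsub) fun σ hσ => ?_
    refine h' σ (hsub (Ioo_subset_Icc_self hσ)) ?_
    by_contra! hle
    exact absurd (le_csSup hbdd ⟨⟨hτ.1.1.trans hσ.1.le, hσ.2.le⟩, hle⟩) (not_le.2 hσ.1)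
  have := hanti (left_mem_Icc.2 hτ.1.2) (right_mem_Icc.2 hτ.1.2) hτ.1.2
  linarith [hτ.2]

theorem hasDerivWithinAt_mul_exp {φ : ℝ → ℝ} {φ' c t : ℝ} {I : Set ℝ}
    (h : HasDerivWithinAt φ φ' I t) :
    HasDerivWithinAt (fun t => φ t * Real.exp (c * t)) ((φ' + c * φ t) * Real.exp (c * t)) I t := by
  have h1 : HasDerivWithinAt (fun t : ℝ => Real.exp (c * t)) (Real.exp (c * t) * (c * 1)) I t :=
    ((hasDerivWithinAt_id t I).const_mul c).exp
  refine (h.mul h1).congr_deriv ?_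
  ring

/-- Gronwall's inequality for a decay rate `c`. -/
theorem le_mul_exp_of_hasDerivWithinAt_le {φ φ' : ℝ → ℝ} {T c : ℝ}
    (h : ∀ t ∈ Icc 0 T, HasDerivWithinAt φ (φ' t) (Icc 0 T) t)
    (h' : ∀ t ∈ Icc 0 T, φ' t ≤ -c * φ t) :
    ∀ t ∈ Icc 0 T, φ t ≤ φ 0 * Real.exp (-c * t) := by
  intro t ht
  have hanti : AntitoneOn (fun t => φ t * Real.exp (c * t)) (Icc 0 T) := by
    refine antitoneOn_Icc_of_hasDerivWithinAt (fun t ht => hasDerivWithinAt_mul_exp (h t ht)) ?_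
    intro t ht
    have := h' t (Ioo_subset_Icc_self ht)
    exact mul_nonpos_of_nonpos_of_nonneg (by linarith) (Real.exp_pos _).le
  have h1 := hanti ⟨le_rfl, ht.1.trans ht.2⟩ ht ht.1
  simp only [mul_zero, Real.exp_zero, mul_one] at h1
  calc φ t = φ t * Real.exp (c * t) * Real.exp (-c * t) := by
        rw [mul_assoc, ← Real.exp_add]; simp
    _ ≤ _ := by gcongr

/-! ### Criteria for stability -/

section Stability

variable {n : ℕ} {f : (Fin n → ℝ) → (Fin n → ℝ)} {S : Set (Fin n → ℝ)} {e : Fin n → ℝ}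

/-- Stability of `e` for solutions that are known to stay in the ball of radius `ρ`. -/
def StableWithin (f : (Fin n → ℝ) → (Fin n → ℝ)) (S : Set (Fin n → ℝ)) (e : Fin n → ℝ)
    (ρ : ℝ) : Prop :=
  ∀ ε > 0, ∃ r > 0, ∀ T ≥ 0, ∀ u, IsSolutionOn f S (Icc 0 T) u →
    (∀ t ∈ Icc 0 T, dist (u t) e ≤ ρ) → dist (u 0) e < r → ∀ t ∈ Icc 0 T, dist (u t) e < ε

/-- First-exit argument: until it first reaches distance `min ε ρ`, a solution is confined to the
ball of radius `ρ`, so the hypothesis applies on that time interval and excludes the exit. -/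
theorem StableWithin.exists_dist_lt {ρ : ℝ} (h : StableWithin f S e ρ) (hρ : 0 < ρ) {ε : ℝ}
    (hε : 0 < ε) : ∃ r > 0, ∀ T ≥ 0, ∀ u, IsSolutionOn f S (Icc 0 T) u → dist (u 0) e < r →
      ∀ t ∈ Icc 0 T, dist (u t) e < ε := by
  obtain ⟨r, hr, H⟩ := h (min ε ρ) (lt_min hε hρ)
  refine ⟨min r (min ε ρ), lt_min hr (lt_min hε hρ), fun T hT u hu h0 t ht => ?_⟩
  by_contra! hlt
  have hcont : ContinuousOn (fun t => dist (u t) e) (Icc 0 t) :=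
    (continuous_id.dist continuous_const).comp_continuousOn
      (hu.continuousOn.mono (Icc_subset_Icc_right ht.2))
  have hclosed : IsClosed {τ ∈ Icc 0 t | min ε ρ ≤ dist (u τ) e} :=
    hcont.preimage_isClosed_of_isClosed isClosed_Icc isClosed_Ici
  have hne : {τ ∈ Icc 0 t | min ε ρ ≤ dist (u τ) e}.Nonempty :=
    ⟨t, ⟨ht.1, le_rfl⟩, (min_le_left _ _).trans hlt⟩
  have hbdd : BddBelow {τ ∈ Icc 0 t | min ε ρ ≤ dist (u τ) e} := ⟨0, fun τ hτ => hτ.1.1⟩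
  set τ := sInf {τ ∈ Icc 0 t | min ε ρ ≤ dist (u τ) e}
  have hτ : τ ∈ {τ ∈ Icc 0 t | min ε ρ ≤ dist (u τ) e} := hclosed.csInf_mem hne hbdd
  have hlt' : ∀ σ ∈ Ico 0 τ, dist (u σ) e < min ε ρ := by
    intro σ hσ
    by_contra! hle
    exact absurd (csInf_le hbdd ⟨⟨hσ.1, hσ.2.le.trans hτ.1.2⟩, hle⟩) (not_le.2 hσ.2)
  have hτ0 : 0 < τ := by
    rcases hτ.1.1.eq_or_lt with h0' | h0'
    · have := hτ.2
      rw [← h0'] at this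
      exact absurd (h0.trans_le (min_le_right _ _)) (not_lt.2 this)
    · exact h0'
  have hle : ∀ σ ∈ Icc 0 τ, dist (u σ) e ≤ min ε ρ := by
    have hc : ContinuousOn (fun t => dist (u t) e) (closure (Ico 0 τ)) := by
      rw [closure_Ico hτ0.ne]
      exact hcont.mono (Icc_subset_Icc_right hτ.1.2)
    intro σ hσ
    rw [← closure_Ico hτ0.ne] at hσ
    exact le_on_closure (fun y hy => (hlt' y hy).le) hc continuousOn_const hσ
  have := H τ hτ0.le u (hu.mono (Icc_subset_Icc_right (hτ.1.2.trans ht.2)))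
    (fun σ hσ => (hle σ hσ).trans (min_le_right _ _)) (h0.trans_le (min_le_left _ _)) τ
    ⟨hτ0.le, le_rfl⟩
  exact absurd this (not_lt.2 hτ.2)

theorem StableWithin.lyapunovStable {ρ : ℝ} (h : StableWithin f S e ρ) (hρ : 0 < ρ)
    (hex : ∀ x ∈ S, ∃ u, IsSolutionOn f S (Ici 0) u ∧ u 0 = x) : LyapunovStable f S e := by
  intro ε hε
  obtain ⟨r, hr, H⟩ := h.exists_dist_lt hρ hε
  exact ⟨r, hr, fun x hx hxr => ⟨hex x hx, fun T hT u hu h0 => H T hT u hu (h0 ▸ hxr)⟩⟩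

/-- On the whole space, stability comes with global existence. -/
theorem StableWithin.lyapunovStable_univ {ρ : ℝ} (h : StableWithin f univ e ρ) (hρ : 0 < ρ)
    {K : NNReal} (hf : LipschitzOnWith K f (Metric.closedBall e ρ)) :
    LyapunovStable f univ e := by
  -- Balls of the sup metric are boxes, so the field can be frozen outside the ball by `clamp`.
  have hbox : Metric.closedBall e ρ = Icc (e - fun _ => ρ) (e + fun _ => ρ) := by
    rw [closedBall_pi _ hρ.le, ← pi_univ_Icc]
    simp only [Real.closedBall_eq_Icc, Pi.sub_apply, Pi.add_apply]
  have hab : (e - fun _ => ρ) ≤ (e + fun _ => ρ) := fun i => by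
    simp only [Pi.sub_apply, Pi.add_apply]; linarith
  have hsol : ∀ I u, IsSolutionOn (fun w => f (clamp (e - fun _ => ρ) (e + fun _ => ρ) w)) univ I u →
      (∀ t ∈ I, dist (u t) e ≤ ρ) → IsSolutionOn f univ I u := by
    intro I u hu hd t ht
    have hm : u t ∈ Icc (e - fun _ => ρ) (e + fun _ => ρ) := hbox ▸ hd t ht
    have := (hu t ht).2
    simp only [clamp_of_mem hm] at this
    exact ⟨mem_univ _, this⟩
  -- Stability within the ball passes to the frozen field. Its global solutions that start near `e`
  -- thus never leave the ball, where they solve the original equation.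
  have hg : StableWithin (fun w => f (clamp (e - fun _ => ρ) (e + fun _ => ρ) w)) univ e ρ := by
    intro ε hε
    obtain ⟨r, hr, H⟩ := h ε hε
    exact ⟨r, hr, fun T hT u hu hd h0 => H T hT u (hsol _ u hu hd) hd h0⟩
  intro ε hε
  obtain ⟨r, hr, H⟩ := h.exists_dist_lt hρ hε
  obtain ⟨r', hr', H'⟩ := hg.exists_dist_lt hρ hρ
  refine ⟨min r r', lt_min hr hr', fun x _ hxr => ⟨?_, fun T hT u hu h0 =>
    H T hT u hu (h0 ▸ hxr.trans_le (min_le_left _ _))⟩⟩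
  obtain ⟨u, hu, hu0⟩ := exists_solution_clamp hab (hbox ▸ hf) x
  refine ⟨u, hsol _ u hu fun t ht => ?_, hu0⟩
  exact (H' t ht u (hu.mono Icc_subset_Ici_self) (hu0 ▸ hxr.trans_le (min_le_right _ _)) t
    ⟨ht, le_rfl⟩).le

/-- A stable equilibrium is attractive if solutions near it come arbitrarily close to it. -/
theorem LyapunovStable.asymptoticallyStable (h : LyapunovStable f S e) {ρ : ℝ} (hρ : 0 < ρ)
    (hatt : ∀ u, IsSolutionOn f S (Ici 0) u → (∀ t ≥ 0, dist (u t) e ≤ ρ) →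
      ∀ r > 0, ∃ t ≥ 0, dist (u t) e < r) : AsymptoticallyStable f S e := by
  refine ⟨h, ?_⟩
  obtain ⟨r, hr, H⟩ := h ρ hρ
  refine ⟨r, hr, fun u hu h0 => Metric.tendsto_atTop.2 fun ε hε => ?_⟩
  have hd : ∀ t ≥ 0, dist (u t) e ≤ ρ := fun t ht =>
    ((H (u 0) (hu 0 (mem_Ici.2 le_rfl)).1 h0).2 t ht u (hu.mono Icc_subset_Ici_self) rfl t ⟨ht, le_rfl⟩).le
  obtain ⟨r', hr', H'⟩ := h ε hε
  obtain ⟨a, ha, har⟩ := hatt u hu hd r' hr'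
  refine ⟨a, fun t hat => ?_⟩
  -- Stability is applied afresh to the solution restarted at time `a`.
  have := (H' (u a) (hu a ha).1 har).2 (t - a) (sub_nonneg.2 hat) (fun t => u (a + t))
    ((hu.shift ha).mono Icc_subset_Ici_self) (by simp) (t - a) ⟨sub_nonneg.2 hat, le_rfl⟩
  simpa using this

theorem AsymptoticallyStable.of_univ (h : AsymptoticallyStable f univ e)
    (hex : ∀ x ∈ S, ∃ u, IsSolutionOn f S (Ici 0) u ∧ u 0 = x) : AsymptoticallyStable f S e := by
  obtain ⟨h1, r, hr, h2⟩ := h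
  refine ⟨fun ε hε => ?_, r, hr, fun u hu => h2 u hu.univ⟩
  obtain ⟨r, hr, H⟩ := h1 ε hε
  exact ⟨r, hr, fun x hx hxr => ⟨hex x hx, fun T hT u hu => (H x (mem_univ _) hxr).2 T hT u hu.univ⟩⟩

theorem Unstable.not_lyapunovStable (h : Unstable f S e) : ¬ LyapunovStable f S e := by
  obtain ⟨ε, hε, H⟩ := h
  intro hs
  obtain ⟨r, hr, H'⟩ := hs ε hε
  obtain ⟨T, hT, u, hu, h0, h1⟩ := H r hr
  exact absurd ((H' (u 0) (hu 0 ⟨le_rfl, hT⟩).1 h0).2 T hT u hu rfl T ⟨hT, le_rfl⟩) (not_lt.2 h1)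

end Stability

/-! ### Equilibria and orbits -/

section Orbits

variable {n : ℕ} {f g : (Fin n → ℝ) → (Fin n → ℝ)} {S : Set (Fin n → ℝ)} {e x : Fin n → ℝ}

/-- Uniqueness forbids leaving an equilibrium in finite time. With the converse below, this
describes equilibria by orbits alone. -/
theorem positiveOrbit_eq_singleton (hf : LipschitzOnBounded f S) (he : e ∈ equilibria f S) :
    positiveOrbit f S e = {e} := by
  have hconst : ∀ T, IsSolutionOn f S (Icc 0 T) (fun _ => e) := fun T t _ =>
    ⟨he.1, by rw [he.2]; exact hasDerivWithinAt_const _ _ _⟩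
  ext y
  constructor
  · rintro ⟨T, hT, u, hu, h0, h1⟩
    rw [mem_singleton_iff, ← h1]
    exact hf.eqOn hu (hconst T) h0 ⟨hT, le_rfl⟩
  · rintro rfl
    exact ⟨0, le_rfl, _, hconst 0, rfl, rfl⟩

theorem mem_equilibria_of_positiveOrbit_subset
    (hex : ∃ u, IsSolutionOn f S (Ici 0) u ∧ u 0 = x) (h : positiveOrbit f S x ⊆ {x}) :
    x ∈ equilibria f S := by
  obtain ⟨u, hu, h0⟩ := hex
  have hc : ∀ t ∈ Ici (0 : ℝ), u t = x := fun t ht =>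
    h ⟨t, ht, u, hu.mono Icc_subset_Ici_self, h0, rfl⟩
  have hu0 := hu 0 (mem_Ici.2 le_rfl)
  rw [h0] at hu0
  refine ⟨hu0.1, ?_⟩
  have h2 : HasDerivWithinAt u 0 (Ici 0) 0 :=
    (hasDerivWithinAt_const (0 : ℝ) (Ici 0) x).congr hc h0
  exact (uniqueDiffOn_Ici (0 : ℝ) 0 (mem_Ici.2 le_rfl)).eq_deriv _ hu0.2 h2

/-- A topological equivalence maps equilibria to equilibria. -/
theorem TopologicallyEquivalent.exists_injOn_equilibria (h : TopologicallyEquivalent f g S)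
    (hf : LipschitzOnBounded f S)
    (hg : ∀ x ∈ S, ∃ u, IsSolutionOn g S (Ici 0) u ∧ u 0 = x) :
    ∃ φ : (Fin n → ℝ) → (Fin n → ℝ), MapsTo φ (equilibria f S) (equilibria g S) ∧
      InjOn φ (equilibria f S) := by
  classical
  obtain ⟨h, hh⟩ := h
  refine ⟨fun x => if hx : x ∈ S then h ⟨x, hx⟩ else x, fun e he => ?_, fun e he e' he' hee => ?_⟩
  · simp only [he.1, dif_pos]
    refine mem_equilibria_of_positiveOrbit_subset (hg _ (h ⟨e, he.1⟩).2) fun y hy => ?_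
    have hyS : y ∈ S := by
      obtain ⟨T, hT, u, hu, -, h1⟩ := hy
      exact h1 ▸ (hu T ⟨hT, le_rfl⟩).1
    -- The preimage of a point on the orbit of `h e` lies on the orbit of `e`, which is a single
    -- point.
    have h2 := (hh ⟨e, he.1⟩ (h.symm ⟨y, hyS⟩)).2 (by simpa using hy)
    rw [positiveOrbit_eq_singleton hf he, mem_singleton_iff] at h2
    have h3 : h.symm ⟨y, hyS⟩ = ⟨e, he.1⟩ := Subtype.ext h2
    rw [h.symm_apply_eq] at h3
    exact congrArg Subtype.val h3
  · simp only [he.1, he'.1, dif_pos] at hee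
    exact congrArg Subtype.val (h.injective (Subtype.ext hee))

end Orbits

/-! ### Bounded Lipschitz functions -/

section BoundedLipschitz

variable {α : Type*} [PseudoMetricSpace α] {A : Set α} {φ ψ : α → ℝ}

/-- `φ` is bounded and Lipschitz on `A`. -/
def BoundedLipschitzOn (φ : α → ℝ) (A : Set α) : Prop :=
  ∃ C, 0 ≤ C ∧ (∀ u ∈ A, |φ u| ≤ C) ∧ ∀ u ∈ A, ∀ w ∈ A, |φ u - φ w| ≤ C * dist u w

theorem BoundedLipschitzOn.const (c : ℝ) : BoundedLipschitzOn (fun _ : α => c) A :=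
  ⟨|c|, abs_nonneg c, fun _ _ => le_rfl, fun u _ w _ => by
    rw [sub_self, abs_zero]; exact mul_nonneg (abs_nonneg c) dist_nonneg⟩

theorem BoundedLipschitzOn.add (hφ : BoundedLipschitzOn φ A) (hψ : BoundedLipschitzOn ψ A) :
    BoundedLipschitzOn (fun u => φ u + ψ u) A := by
  obtain ⟨C, hC, hb, hl⟩ := hφ
  obtain ⟨D, hD, hb', hl'⟩ := hψ
  refine ⟨C + D, add_nonneg hC hD, fun u hu => (abs_add_le _ _).trans (add_le_add (hb u hu) (hb' u hu)),
    fun u hu w hw => ?_⟩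
  calc |φ u + ψ u - (φ w + ψ w)| = |(φ u - φ w) + (ψ u - ψ w)| := by ring_nf
    _ ≤ _ := (abs_add_le _ _).trans (add_le_add (hl u hu w hw) (hl' u hu w hw))
    _ = _ := by ring

theorem BoundedLipschitzOn.mul (hφ : BoundedLipschitzOn φ A) (hψ : BoundedLipschitzOn ψ A) :
    BoundedLipschitzOn (fun u => φ u * ψ u) A := by
  obtain ⟨C, hC, hb, hl⟩ := hφ
  obtain ⟨D, hD, hb', hl'⟩ := hψ
  have hCD := mul_nonneg hC hD
  refine ⟨2 * (C * D), by positivity, fun u hu => ?_, fun u hu w hw => ?_⟩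
  · rw [abs_mul]
    calc _ ≤ C * D := mul_le_mul (hb u hu) (hb' u hu) (abs_nonneg _) hC
      _ ≤ _ := by linarith
  · calc |φ u * ψ u - φ w * ψ w| = |φ u * (ψ u - ψ w) + (φ u - φ w) * ψ w| := by ring_nf
      _ ≤ |φ u| * |ψ u - ψ w| + |φ u - φ w| * |ψ w| := by
        simpa only [abs_mul] using abs_add_le (φ u * (ψ u - ψ w)) ((φ u - φ w) * ψ w)
      _ ≤ C * (D * dist u w) + C * dist u w * D := by
        gcongr
        · exact hb u hu
        · exact hl' u hu w hw
        · exact hl u hu w hw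
        · exact hb' w hw
      _ = _ := by ring

theorem BoundedLipschitzOn.comp {B : Set ℝ} {k : ℝ → ℝ} (hk : BoundedLipschitzOn k B)
    (hφ : BoundedLipschitzOn φ A) (hAB : MapsTo φ A B) :
    BoundedLipschitzOn (fun u => k (φ u)) A := by
  obtain ⟨C, hC, hb, hl⟩ := hφ
  obtain ⟨D, hD, hb', hl'⟩ := hk
  refine ⟨max D (D * C), le_max_of_le_left hD, fun u hu => (hb' _ (hAB hu)).trans (le_max_left _ _),
    fun u hu w hw => ?_⟩
  calc |k (φ u) - k (φ w)| ≤ D * dist (φ u) (φ w) := hl' _ (hAB hu) _ (hAB hw)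
    _ ≤ D * (C * dist u w) := by gcongr; exact hl u hu w hw
    _ = D * C * dist u w := by ring
    _ ≤ _ := by gcongr; exact le_max_right _ _

theorem LipschitzWith.boundedLipschitzOn {k : ℝ → ℝ} {K : NNReal} (hk : LipschitzWith K k) (R : ℝ) :
    BoundedLipschitzOn k (Icc (-R) R) := by
  obtain ⟨M, hM⟩ := isCompact_Icc.exists_bound_of_continuousOn
    (hk.continuous.continuousOn (s := Icc (-R) R))
  refine ⟨max (max M 0) K, le_max_of_le_left (le_max_right _ _), fun u hu => ?_, fun u _ w _ => ?_⟩
  · exact (hM u hu).trans ((le_max_left _ _).trans (le_max_left _ _))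
  · calc _ ≤ K * dist u w := hk.dist_le_mul u w
      _ ≤ _ := by gcongr; exact le_max_right _ _

theorem boundedLipschitzOn_rpow {p : ℝ} (hp : 1 ≤ p) (R : ℝ) :
    BoundedLipschitzOn (fun x : ℝ => x ^ p) (Icc 0 R) := by
  rcases lt_or_ge R 0 with hR | hR
  · exact ⟨0, le_rfl, fun u hu => absurd (hu.1.trans hu.2) (not_le.2 hR),
      fun u hu => absurd (hu.1.trans hu.2) (not_le.2 hR)⟩
  refine ⟨max (R ^ p) (p * R ^ (p - 1)), le_max_of_le_left (by positivity), fun u hu => ?_,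
    fun u hu w hw => ?_⟩
  · rw [abs_of_nonneg (Real.rpow_nonneg hu.1 _)]
    exact (Real.rpow_le_rpow hu.1 hu.2 (by linarith)).trans (le_max_left _ _)
  · have h := (convex_Icc 0 R).norm_image_sub_le_of_norm_hasDerivWithin_le
      (f := fun x : ℝ => x ^ p) (f' := fun x => p * x ^ (p - 1)) (C := p * R ^ (p - 1))
      (fun x _ => (Real.hasDerivAt_rpow_const (Or.inr hp)).hasDerivWithinAt) (fun x hx => ?_) hw hu
    · refine h.trans ?_
      rw [← dist_eq_norm]
      gcongr
      exact le_max_right _ _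
    · have h0 := Real.rpow_nonneg hx.1 (p - 1)
      rw [Real.norm_of_nonneg (by positivity)]
      gcongr
      · exact hx.1
      · exact hx.2

theorem boundedLipschitzOn_apply {n : ℕ} (i : Fin n) {A : Set (Fin n → ℝ)} {R : ℝ}
    (hA : A ⊆ Metric.closedBall 0 R) : BoundedLipschitzOn (fun u : Fin n → ℝ => u i) A := by
  refine ⟨max R 1, le_max_of_le_right zero_le_one, fun u hu => ?_, fun u _ w _ => ?_⟩
  · exact ((norm_le_pi_norm u i).trans (mem_closedBall_zero_iff.1 (hA hu))).trans (le_max_left _ _)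
  · calc |u i - w i| ≤ 1 * dist u w := by rw [one_mul]; exact dist_le_pi_dist u w i
      _ ≤ _ := by gcongr; exact le_max_right _ _

theorem exists_lipschitzOnWith_of_boundedLipschitzOn {n : ℕ} {f : α → Fin n → ℝ}
    (h : ∀ i, BoundedLipschitzOn (fun u => f u i) A) : ∃ K, LipschitzOnWith K f A := by
  choose C hC _ hl using h
  have hs : 0 ≤ ∑ i, C i := Finset.sum_nonneg fun i _ => hC i
  refine ⟨(∑ i, C i).toNNReal, LipschitzOnWith.of_dist_le_mul fun u hu w hw => ?_⟩
  rw [Real.coe_toNNReal _ hs]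
  refine (dist_pi_le_iff (mul_nonneg hs dist_nonneg)).2 fun i => (hl i u hu w hw).trans ?_
  gcongr
  exact Finset.single_le_sum (fun i _ => hC i) (Finset.mem_univ i)

end BoundedLipschitz

/-! ### The soil model -/

namespace SoilModel

variable {P : SoilModel} {s : ℝ}

theorem field_zero (P : SoilModel) (s : ℝ) (u : Fin 3 → ℝ) : P.field s u 0 =
    -P.k₁ (u 1) * u 0 - P.δ * P.k₃ (u 2) * u 1 * u 0 ^ P.δ + P.η * P.k₄ * u 1 + s := rfl

theorem field_one (P : SoilModel) (s : ℝ) (u : Fin 3 → ℝ) : P.field s u 1 =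
    P.μ * P.k₃ (u 2) * u 1 * u 0 ^ P.δ - P.k₄ * u 1 := rfl

theorem field_two (P : SoilModel) (s : ℝ) (u : Fin 3 → ℝ) : P.field s u 2 =
    -P.k₂ (u 1) * u 2 := rfl

/-- The decomposition terms cancel in this weighted mass. As `ημ ≤ δ`, the mass grows in the octant
at most at rate `μ s`, which rules out blow-up. -/
theorem field_mass (P : SoilModel) (s : ℝ) (u : Fin 3 → ℝ) :
    P.μ * P.field s u 0 + P.δ * P.field s u 1 =
      P.μ * s - P.μ * P.k₁ (u 1) * u 0 - (P.δ - P.η * P.μ) * P.k₄ * u 1 := by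
  rw [field_zero, field_one]; ring

theorem Admissible.δ_pos (hP : P.Admissible) : 0 < P.δ := lt_of_lt_of_le one_pos hP.one_le_δ

theorem Admissible.exists_lipschitzOnWith (hP : P.Admissible) (s : ℝ) {A : Set (Fin 3 → ℝ)} {R : ℝ}
    (hA : A ⊆ Metric.closedBall 0 R) (h0 : ∀ u ∈ A, 0 ≤ u 0) :
    ∃ K, LipschitzOnWith K (P.field s) A := by
  obtain ⟨K₁, hK₁⟩ := hP.k₁_lipschitz
  obtain ⟨K₂, hK₂⟩ := hP.k₂_lipschitz
  obtain ⟨K₃, hK₃⟩ := hP.k₃_lipschitz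
  have hcoord : ∀ i, BoundedLipschitzOn (fun u : Fin 3 → ℝ => u i) A :=
    fun i => boundedLipschitzOn_apply i hA
  have habs : ∀ i, ∀ u ∈ A, |u i| ≤ R := fun i u hu =>
    (norm_le_pi_norm u i).trans (mem_closedBall_zero_iff.1 (hA hu))
  have h1 : BoundedLipschitzOn (fun u : Fin 3 → ℝ => P.k₁ (u 1)) A :=
    (hK₁.boundedLipschitzOn R).comp (hcoord 1) fun u hu => abs_le.1 (habs 1 u hu)
  have h2 : BoundedLipschitzOn (fun u : Fin 3 → ℝ => P.k₂ (u 1)) A :=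
    (hK₂.boundedLipschitzOn R).comp (hcoord 1) fun u hu => abs_le.1 (habs 1 u hu)
  have h3 : BoundedLipschitzOn (fun u : Fin 3 → ℝ => P.k₃ (u 2)) A :=
    (hK₃.boundedLipschitzOn R).comp (hcoord 2) fun u hu => abs_le.1 (habs 2 u hu)
  have hp : BoundedLipschitzOn (fun u : Fin 3 → ℝ => u 0 ^ P.δ) A :=
    (boundedLipschitzOn_rpow hP.one_le_δ R).comp (hcoord 0)
      fun u hu => ⟨h0 u hu, (le_abs_self _).trans (habs 0 u hu)⟩
  have hr := (h3.mul (hcoord 1)).mul hp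
  refine exists_lipschitzOnWith_of_boundedLipschitzOn fun i => ?_
  fin_cases i
  · convert ((((BoundedLipschitzOn.const (-1)).mul h1).mul (hcoord 0)).add
      ((BoundedLipschitzOn.const (-P.δ)).mul hr)).add
      (((BoundedLipschitzOn.const (P.η * P.k₄)).mul (hcoord 1)).add (BoundedLipschitzOn.const s))
      using 2 with u
    simp only [Fin.zero_eta, field_zero]; ring
  · convert ((BoundedLipschitzOn.const P.μ).mul hr).add
      ((BoundedLipschitzOn.const (-P.k₄)).mul (hcoord 1)) using 2 with u
    simp only [Fin.mk_one, field_one]; ring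
  · convert ((BoundedLipschitzOn.const (-1)).mul h2).mul (hcoord 2) using 2 with u
    simp only [Fin.reduceFinMk, field_two]; ring

theorem Admissible.lipschitzOnBounded_octant (hP : P.Admissible) (s : ℝ) :
    LipschitzOnBounded (P.field s) octant := fun R =>
  hP.exists_lipschitzOnWith s (R := R) inter_subset_right fun _ hu => hu.1 0

/-- Every point of the octant is the initial value of a global solution in the octant. -/
theorem Admissible.exists_solution_octant (hP : P.Admissible) (hs : 0 ≤ s) {x : Fin 3 → ℝ}
    (hx : x ∈ octant) : ∃ u, IsSolutionOn (P.field s) octant (Ici 0) u ∧ u 0 = x := by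
  refine (hP.lipschitzOnBounded_octant s).exists_Ici fun T hT => ?_
  have hμ := hP.μ_pos
  have hδ := hP.δ_pos
  have hx0 := hx 0
  have hx1 := hx 1
  have hx2 := hx 2
  -- A bound for the weighted mass up to time `T`. The box of side `M` contains every state that
  -- this bound and the decay of charcoal allow, so freezing outside it has no effect up to time
  -- `T`.
  set m := P.μ * x 0 + P.δ * x 1 + P.μ * s * T with hm
  have hm0 : 0 ≤ m := by positivity
  set M := m / P.μ + m / P.δ + x 2 with hM
  have hM0 : 0 ≤ M := by positivity
  have hab : (0 : Fin 3 → ℝ) ≤ fun _ => M := fun _ => hM0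
  have hbox : Icc (0 : Fin 3 → ℝ) (fun _ => M) ⊆ Metric.closedBall 0 M := by
    intro w hw
    rw [mem_closedBall_zero_iff]
    refine (pi_norm_le_iff_of_nonneg hM0).2 fun i => ?_
    rw [Real.norm_eq_abs, abs_of_nonneg (hw.1 i)]
    exact hw.2 i
  obtain ⟨K, hK⟩ := hP.exists_lipschitzOnWith s hbox fun w hw => hw.1 0
  obtain ⟨u, hu, hu0⟩ := exists_solution_clamp hab hK x
  have huT := hu.mono (show Icc 0 T ⊆ Ici 0 from Icc_subset_Ici_self)
  set c := clamp (0 : Fin 3 → ℝ) (fun _ => M) with hc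
  have hcm : ∀ w, c w ∈ Icc (0 : Fin 3 → ℝ) (fun _ => M) := fun w => clamp_mem hab w
  have hc0 : ∀ w i, w i < 0 → c w i = 0 := by
    intro w i hw
    simp only [hc, clamp, Pi.zero_apply]
    exact max_eq_left ((min_le_right _ _).trans hw.le)
  -- A coordinate that has become negative is clamped to `0`, where the corresponding component of
  -- the field is nonnegative; so it cannot have become negative.
  have hpos : ∀ i, ∀ t ∈ Icc 0 T, 0 ≤ u t i := by
    intro i t ht
    have := le_of_hasDerivWithinAt_nonpos_above (φ := fun t => -u t i)
      (φ' := fun t => -P.field s (c (u t)) i) (c := 0)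
      (fun t ht => (huT.hasDerivWithinAt_apply ht i).fun_neg) (fun t ht hlt => ?_)
      (by simpa [hu0] using hx i) t ht
    · simpa using this
    · have hz := hc0 (u t) i (by linarith)
      have h1 := (hcm (u t)).1 1
      simp only [Pi.zero_apply] at h1
      rw [neg_nonpos]
      revert hz
      fin_cases i <;> intro hz
      · simp only [Fin.zero_eta] at hz ⊢
        rw [field_zero, hz, Real.zero_rpow hδ.ne']
        have := mul_nonneg (mul_nonneg hP.η_pos.le hP.k₄_pos.le) h1
        linarith
      · simp only [Fin.mk_one] at hz ⊢
        rw [field_one, hz]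
        simp
      · simp only [Fin.reduceFinMk] at hz ⊢
        rw [field_two, hz]
        simp
  have hmass : ∀ t ∈ Icc 0 T, P.μ * u t 0 + P.δ * u t 1 ≤ m := by
    intro t ht
    have hanti := antitoneOn_Icc_of_hasDerivWithinAt
      (φ := fun t => P.μ * u t 0 + P.δ * u t 1 - P.μ * s * t)
      (φ' := fun t => P.μ * P.field s (c (u t)) 0 + P.δ * P.field s (c (u t)) 1 - P.μ * s * 1)
      (a := 0) (b := T)
      (fun t ht => (((huT.hasDerivWithinAt_apply ht 0).const_mul P.μ).add
        ((huT.hasDerivWithinAt_apply ht 1).const_mul P.δ)).sub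
          ((hasDerivWithinAt_id t _).const_mul (P.μ * s))) (fun t ht => ?_)
    · have h1 := hanti ⟨le_rfl, hT⟩ ht ht.1
      simp only [hu0] at h1
      have h2 : P.μ * s * t ≤ P.μ * s * T := by gcongr; exact ht.2
      linarith
    · rw [field_mass]
      have h0 := (hcm (u t)).1 0
      have h1 := (hcm (u t)).1 1
      simp only [Pi.zero_apply] at h0 h1
      have h2 := mul_nonneg (mul_nonneg hμ.le (hP.k₁_pos (c (u t) 1)).le) h0
      have h3 := mul_nonneg (mul_nonneg (sub_nonneg.2 hP.ημ_le_δ) hP.k₄_pos.le) h1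
      linarith
  have htwo : ∀ t ∈ Icc 0 T, u t 2 ≤ x 2 := by
    intro t ht
    have hanti := antitoneOn_Icc_of_hasDerivWithinAt (a := 0) (b := T)
      (fun t ht => huT.hasDerivWithinAt_apply ht 2) (fun t ht => ?_)
    · have h1 := hanti ⟨le_rfl, hT⟩ ht ht.1
      simpa only [hu0] using h1
    · rw [field_two]
      have h2 := (hcm (u t)).1 2
      simp only [Pi.zero_apply] at h2
      have := mul_nonneg (hP.k₂_pos (c (u t) 1)).le h2
      linarith
  have hmem : ∀ t ∈ Icc 0 T, u t ∈ Icc (0 : Fin 3 → ℝ) (fun _ => M) := by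
    intro t ht
    refine ⟨fun i => hpos i t ht, fun i => ?_⟩
    have h0 := mul_nonneg hμ.le (hpos 0 t ht)
    have h1 := mul_nonneg hδ.le (hpos 1 t ht)
    have h2 := hmass t ht
    have h3 : u t 0 ≤ m / P.μ := by rw [le_div_iff₀ hμ]; linarith
    have h4 : u t 1 ≤ m / P.δ := by rw [le_div_iff₀ hδ]; linarith
    have h5 : 0 ≤ m / P.μ := by positivity
    have h6 : 0 ≤ m / P.δ := by positivity
    have h7 := htwo t ht
    fin_cases i <;> simp only [Fin.zero_eta, Fin.mk_one, Fin.reduceFinMk] <;> linarith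
  refine ⟨u, fun t ht => ⟨fun i => hpos i t ht, ?_⟩, hu0⟩
  have := (huT t ht).2
  beta_reduce at this
  rwa [hc, clamp_of_mem (hmem t ht)] at this

/-! ### Equilibria -/

theorem Admissible.μk₃_pos (hP : P.Admissible) : 0 < P.μ * P.k₃ 0 :=
  mul_pos hP.μ_pos (hP.k₃_pos 0)

theorem Admissible.U₁_pos (hP : P.Admissible) : 0 < P.U₁ :=
  Real.rpow_pos_of_pos (div_pos hP.k₄_pos hP.μk₃_pos) _

theorem Admissible.U₁_rpow (hP : P.Admissible) : P.U₁ ^ P.δ = P.k₄ / (P.μ * P.k₃ 0) := by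
  rw [U₁, one_div, Real.rpow_inv_rpow (div_pos hP.k₄_pos hP.μk₃_pos).le hP.δ_pos.ne']

theorem Admissible.mul_U₁_rpow (hP : P.Admissible) : P.μ * P.k₃ 0 * P.U₁ ^ P.δ = P.k₄ := by
  rw [hP.U₁_rpow, mul_div_cancel₀ _ hP.μk₃_pos.ne']

theorem Admissible.threshold_pos (hP : P.Admissible) : 0 < P.threshold :=
  mul_pos (hP.k₁_pos 0) hP.U₁_pos

/-- The production of `u₁` at `(U₁, w, 0)`, as a function of `w`. -/
def surplus (P : SoilModel) (s w : ℝ) : ℝ :=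
  s - P.k₁ w * P.U₁ - P.k₄ / P.μ * (P.δ - P.η * P.μ) * w

theorem microbeEq_iff {v : ℝ} : P.MicrobeEq s v ↔ P.surplus s v = 0 := by
  rw [MicrobeEq, surplus]
  constructor <;> intro h <;> linarith

theorem surplus_zero : P.surplus s 0 = s - P.threshold := by
  rw [surplus, threshold]; ring

theorem Admissible.slope_nonneg (hP : P.Admissible) : 0 ≤ P.k₄ / P.μ * (P.δ - P.η * P.μ) :=
  mul_nonneg (div_pos hP.k₄_pos hP.μ_pos).le (sub_nonneg.2 hP.ημ_le_δ)

theorem Admissible.surplus_strictAnti (hP : P.Admissible) : StrictAnti (P.surplus s) := by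
  intro a b hab
  have h1 := mul_lt_mul_of_pos_right (hP.k₁_strictMono hab) hP.U₁_pos
  have h2 := mul_le_mul_of_nonneg_left hab.le hP.slope_nonneg
  simp only [surplus]
  linarith

theorem Admissible.continuous_k₁ (hP : P.Admissible) : Continuous P.k₁ :=
  hP.k₁_lipschitz.choose_spec.continuous

theorem Admissible.continuous_k₂ (hP : P.Admissible) : Continuous P.k₂ :=
  hP.k₂_lipschitz.choose_spec.continuous

theorem Admissible.continuous_k₃ (hP : P.Admissible) : Continuous P.k₃ :=
  hP.k₃_lipschitz.choose_spec.continuous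

theorem Admissible.continuous_surplus (hP : P.Admissible) : Continuous (P.surplus s) := by
  have := hP.continuous_k₁
  unfold surplus
  fun_prop

theorem Admissible.existsUnique_microbeEq (hP : P.Admissible) (hs : P.threshold < s) :
    ∃! v, P.MicrobeEq s v := by
  have hex : ∃ v, P.MicrobeEq s v := by
    rcases hP.ημ_le_δ.eq_or_lt with h | h
    · exact hP.solvable h.symm s hs.le
    · have hd : 0 < P.k₄ / P.μ * (P.δ - P.η * P.μ) :=
        mul_pos (div_pos hP.k₄_pos hP.μ_pos) (sub_pos.2 h)
      have hb : 0 ≤ s / (P.k₄ / P.μ * (P.δ - P.η * P.μ)) :=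
        div_nonneg (hP.threshold_pos.trans hs).le hd.le
      -- At the right endpoint the linear term cancels `s` exactly and leaves a negative value; at
      -- `0` the surplus is `s - threshold > 0`.
      obtain ⟨v, -, hv⟩ := intermediate_value_Icc' hb
        (hP.continuous_surplus (s := s)).continuousOn (a := (0 : ℝ)) (show (0 : ℝ) ∈ _ from
        ⟨by rw [surplus, mul_div_cancel₀ _ hd.ne']
            have := mul_pos (hP.k₁_pos (s / (P.k₄ / P.μ * (P.δ - P.η * P.μ)))) hP.U₁_pos
            linarith, by rw [surplus_zero]; linarith⟩)
      exact ⟨v, microbeEq_iff.2 hv⟩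
  obtain ⟨v, hv⟩ := hex
  refine ⟨v, hv, fun w hw => hP.surplus_strictAnti.injective ((microbeEq_iff.1 hw).trans (microbeEq_iff.1 hv).symm)⟩

theorem Admissible.microbeEq_pos (hP : P.Admissible) (hs : P.threshold < s) {v : ℝ}
    (hv : P.MicrobeEq s v) : 0 < v := by
  rw [← hP.surplus_strictAnti.lt_iff_gt (a := v), microbeEq_iff.1 hv, surplus_zero]
  linarith

theorem field_e₂ (hP : P.Admissible) {v : ℝ} : P.field s (P.e₂ v) = ![P.surplus s v, 0, 0] := by
  have hk := hP.mul_U₁_rpow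
  have hμ := hP.μ_pos.ne'
  have h0 : P.e₂ v 0 = P.U₁ := rfl
  have h1 : P.e₂ v 1 = v := rfl
  have h2 : P.e₂ v 2 = 0 := rfl
  ext i
  fin_cases i
  · simp only [Fin.zero_eta, field_zero, h0, h1, h2, Matrix.cons_val_zero, surplus]
    rw [hP.U₁_rpow]
    have := (hP.k₃_pos 0).ne'
    field_simp
    ring
  · simp only [Fin.mk_one, field_one, h0, h1, h2, Matrix.cons_val_one, Matrix.cons_val_zero]
    linear_combination v * hk
  · simp [field_two, h2]

theorem Admissible.field_e₁ (hP : P.Admissible) : P.field s (P.e₁ s) = 0 := by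
  have h0 : P.e₁ s 0 = s / P.k₁ 0 := rfl
  have h1 : P.e₁ s 1 = 0 := rfl
  have h2 : P.e₁ s 2 = 0 := rfl
  have := (hP.k₁_pos 0).ne'
  ext i
  fin_cases i
  · simp only [Fin.zero_eta, field_zero, h0, h1, h2, Pi.zero_apply]
    field_simp
    ring
  · simp [field_one, h1]
  · simp [field_two, h2]

theorem Admissible.e₁_mem_octant (hP : P.Admissible) (hs : 0 ≤ s) : P.e₁ s ∈ octant := by
  intro i
  have := div_nonneg hs (hP.k₁_pos 0).le
  fin_cases i <;> simp [e₁, this]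

/-- An equilibrium in the octant has no microbes, or its microbes balance the source. -/
theorem Admissible.mem_equilibria (hP : P.Admissible) (hs : 0 ≤ s) {u : Fin 3 → ℝ} :
    u ∈ equilibria (P.field s) octant ↔
      u = P.e₁ s ∨ ∃ v, 0 ≤ v ∧ P.MicrobeEq s v ∧ u = P.e₂ v := by
  constructor
  · rintro ⟨hu, h⟩
    have h0 := congrFun h 0
    have h1 := congrFun h 1
    have h2 := congrFun h 2
    rw [field_two, Pi.zero_apply, neg_mul, neg_eq_zero, mul_eq_zero,
      or_iff_right (hP.k₂_pos _).ne'] at h2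
    rw [field_one, h2, Pi.zero_apply] at h1
    have h1' : u 1 * (P.μ * P.k₃ 0 * u 0 ^ P.δ - P.k₄) = 0 := by linear_combination h1
    rcases mul_eq_zero.1 h1' with h1 | h1
    · left
      rw [field_zero, h1, Pi.zero_apply] at h0
      have hk := (hP.k₁_pos 0).ne'
      have hu0 : u 0 = s / P.k₁ 0 := by
        rw [eq_div_iff hk]; linear_combination -h0
      ext i
      fin_cases i <;> simp [e₁, hu0, h1, h2]
    · right
      have hu0 : u 0 = P.U₁ := by
        have h3 : u 0 ^ P.δ = P.U₁ ^ P.δ := by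
          rw [hP.U₁_rpow, eq_div_iff hP.μk₃_pos.ne']; linear_combination h1
        exact (Real.rpow_left_inj (hu 0) hP.U₁_pos.le hP.δ_pos.ne').1 h3
      have hu' : u = P.e₂ (u 1) := by
        ext i
        fin_cases i <;> simp [e₂, hu0, h2]
      refine ⟨u 1, hu 1, microbeEq_iff.2 ?_, hu'⟩
      rw [hu', field_e₂ hP] at h
      exact congrFun h 0
  · rintro (rfl | ⟨v, hv0, hv, rfl⟩)
    · exact ⟨hP.e₁_mem_octant hs, hP.field_e₁⟩
    · refine ⟨fun i => ?_, ?_⟩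
      · have := hP.U₁_pos.le
        fin_cases i <;> simp [e₂, this, hv0]
      · rw [field_e₂ hP, microbeEq_iff.1 hv]
        ext i
        fin_cases i <;> rfl

theorem Admissible.equilibria_of_le (hP : P.Admissible) (hs : 0 ≤ s) (h : s ≤ P.threshold) :
    equilibria (P.field s) octant = {P.e₁ s} := by
  ext u
  rw [hP.mem_equilibria hs, mem_singleton_iff, or_iff_left_of_imp]
  rintro ⟨v, hv0, hv, rfl⟩
  have h1 : P.surplus s v ≤ P.surplus s 0 := hP.surplus_strictAnti.antitone hv0
  rw [surplus_zero, microbeEq_iff.1 hv] at h1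
  -- A second solution can occur only at the threshold and with `v = 0`, where `e₂` merges with
  -- `e₁`.
  have hst : s = P.threshold := le_antisymm h (by linarith)
  have hv' : v = 0 := by
    refine hP.surplus_strictAnti.injective ((microbeEq_iff.1 hv).trans ?_)
    rw [surplus_zero, hst, sub_self]
  have hk := (hP.k₁_pos 0).ne'
  rw [hv', hst, e₁, e₂, threshold, mul_div_cancel_left₀ _ hk]

theorem Admissible.equilibria_of_lt (hP : P.Admissible) (hs : P.threshold < s) {v : ℝ}
    (hv : P.MicrobeEq s v) : equilibria (P.field s) octant = {P.e₁ s, P.e₂ v} := by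
  ext u
  rw [hP.mem_equilibria (hP.threshold_pos.trans hs).le, mem_insert_iff, mem_singleton_iff]
  refine or_congr_right ⟨?_, fun h => ⟨v, (hP.microbeEq_pos hs hv).le, hv, h⟩⟩
  rintro ⟨w, -, hw, rfl⟩
  rw [(hP.existsUnique_microbeEq hs).unique hw hv]

/-! ### The bifurcation -/

theorem e₁_ne_e₂ {v : ℝ} (hv : 0 < v) : P.e₁ s ≠ P.e₂ v := fun h =>
  hv.ne (congrFun h 1)

/-- Every `s` above the threshold works: an equivalence would inject two equilibria into a set with
one. -/
theorem Admissible.isBifurcationPoint (hP : P.Admissible) :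
    IsBifurcationPoint P.field octant (Ici 0) P.threshold := by
  refine ⟨hP.threshold_pos.le, ?_⟩
  have hfreq : ∃ᶠ s in 𝓝[>] P.threshold, ¬ TopologicallyEquivalent (P.field s)
      (P.field P.threshold) octant := by
    refine Eventually.frequently ?_
    filter_upwards [self_mem_nhdsWithin] with s hs hequiv
    obtain ⟨v, hv, -⟩ := hP.existsUnique_microbeEq hs
    obtain ⟨φ, hmaps, hinj⟩ := hequiv.exists_injOn_equilibria (hP.lipschitzOnBounded_octant s)
      fun x hx => hP.exists_solution_octant hP.threshold_pos.le hx
    rw [hP.equilibria_of_lt hs hv] at hmaps hinj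
    rw [hP.equilibria_of_le hP.threshold_pos.le le_rfl] at hmaps
    refine e₁_ne_e₂ (P := P) (s := s) (hP.microbeEq_pos hs hv) (hinj (by simp) (by simp) ?_)
    rw [mem_singleton_iff.1 (hmaps (mem_insert _ _)),
      mem_singleton_iff.1 (hmaps (mem_insert_of_mem _ (mem_singleton _)))]
  exact hfreq.filter_mono (nhdsWithin_mono _ fun s hs => hP.threshold_pos.le.trans (le_of_lt hs))

end SoilModel

/-! ### Exponential stability -/

section Exponential

variable {n : ℕ} {f : (Fin n → ℝ) → (Fin n → ℝ)} {S : Set (Fin n → ℝ)} {e : Fin n → ℝ}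

/-- Solutions that stay in the ball of radius `ρ` around `e` converge to `e` exponentially. -/
def ExponentiallyStableWithin (f : (Fin n → ℝ) → (Fin n → ℝ)) (S : Set (Fin n → ℝ))
    (e : Fin n → ℝ) (ρ : ℝ) : Prop :=
  ∃ C ≥ 0, ∃ c > 0, ∀ T ≥ 0, ∀ u, IsSolutionOn f S (Icc 0 T) u →
    (∀ t ∈ Icc 0 T, dist (u t) e ≤ ρ) →
    ∀ t ∈ Icc 0 T, dist (u t) e ^ 2 ≤ C * dist (u 0) e ^ 2 * Real.exp (-c * t)

theorem ExponentiallyStableWithin.stableWithin {ρ : ℝ} (h : ExponentiallyStableWithin f S e ρ) :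
    StableWithin f S e ρ := by
  obtain ⟨C, hC, c, hc, H⟩ := h
  intro ε hε
  -- Enough because `C < (C + 1) ^ 2`.
  refine ⟨ε / (C + 1), by positivity, fun T hT u hu hd h0 t ht => ?_⟩
  have h1 := H T hT u hu hd t ht
  have h2 : Real.exp (-c * t) ≤ 1 := Real.exp_le_one_iff.2 (by nlinarith [ht.1])
  have h3 : dist (u 0) e ^ 2 ≤ (ε / (C + 1)) ^ 2 := by gcongr
  have h4 : dist (u t) e ^ 2 ≤ C * (ε / (C + 1)) ^ 2 := by
    calc _ ≤ _ := h1
      _ ≤ C * (ε / (C + 1)) ^ 2 * 1 := by gcongr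
      _ = _ := mul_one _
  have h5 : C * (ε / (C + 1)) ^ 2 < ε ^ 2 := by
    rw [div_pow, ← mul_div_assoc, div_lt_iff₀ (by positivity)]
    nlinarith [sq_nonneg C, sq_pos_of_pos hε]
  exact lt_of_pow_lt_pow_left₀ 2 hε.le (h4.trans_lt h5)

theorem ExponentiallyStableWithin.exists_dist_lt {ρ : ℝ} (h : ExponentiallyStableWithin f S e ρ)
    {u : ℝ → Fin n → ℝ} (hu : IsSolutionOn f S (Ici 0) u) (hd : ∀ t ≥ 0, dist (u t) e ≤ ρ)
    {r : ℝ} (hr : 0 < r) : ∃ t ≥ 0, dist (u t) e < r := by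
  obtain ⟨C, hC, c, hc, H⟩ := h
  have hlim : Tendsto (fun t : ℝ => C * dist (u 0) e ^ 2 * Real.exp (-c * t)) atTop (𝓝 0) := by
    have h1 : Tendsto (fun t : ℝ => -c * t) atTop atBot :=
      tendsto_id.const_mul_atTop_of_neg (neg_neg_of_pos hc)
    simpa using (Real.tendsto_exp_atBot.comp h1).const_mul (C * dist (u 0) e ^ 2)
  obtain ⟨t, ht, ht0⟩ := ((hlim.eventually (gt_mem_nhds (pow_pos hr 2))).and
    (eventually_ge_atTop 0)).exists
  refine ⟨t, ht0, lt_of_pow_lt_pow_left₀ 2 hr.le (lt_of_le_of_lt ?_ ht)⟩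
  exact H t ht0 u (hu.mono Icc_subset_Ici_self) (fun τ hτ => hd τ hτ.1) t ⟨ht0, le_rfl⟩

end Exponential

namespace SoilModel

variable {P : SoilModel} {s : ℝ}

/-! ### The equilibrium without microbes -/

/-- The growth rate of the microbes. -/
def growth (P : SoilModel) (u : Fin 3 → ℝ) : ℝ := P.μ * P.k₃ (u 2) * u 0 ^ P.δ - P.k₄

theorem field_one_eq (P : SoilModel) (s : ℝ) (u : Fin 3 → ℝ) :
    P.field s u 1 = P.growth u * u 1 := by
  rw [field_one, growth]; ring

theorem growth_e₁ : P.growth (P.e₁ s) = P.criticalEigenvalue s := rfl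

theorem Admissible.continuous_rpow (hP : P.Admissible) :
    Continuous fun u : Fin 3 → ℝ => u 0 ^ P.δ :=
  (continuous_apply 0).rpow_const fun _ => Or.inr hP.δ_pos.le

theorem Admissible.continuous_growth (hP : P.Admissible) : Continuous P.growth := by
  have h3 := hP.continuous_k₃
  have := hP.continuous_rpow
  unfold growth
  fun_prop

theorem Admissible.div_lt_U₁_iff (hP : P.Admissible) : s / P.k₁ 0 < P.U₁ ↔ s < P.threshold := by
  rw [div_lt_iff₀ (hP.k₁_pos 0), mul_comm, threshold]

theorem Admissible.lt_div_U₁_iff (hP : P.Admissible) : P.U₁ < s / P.k₁ 0 ↔ P.threshold < s := by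
  rw [lt_div_iff₀ (hP.k₁_pos 0), mul_comm, threshold]

theorem Admissible.criticalEigenvalue_neg (hP : P.Admissible) (hs : 0 ≤ s) (h : s < P.threshold) :
    P.criticalEigenvalue s < 0 := by
  have h1 := Real.rpow_lt_rpow (div_nonneg hs (hP.k₁_pos 0).le) (hP.div_lt_U₁_iff.2 h) hP.δ_pos
  have h2 := mul_lt_mul_of_pos_left h1 hP.μk₃_pos
  rw [hP.mul_U₁_rpow] at h2
  rw [criticalEigenvalue]
  linarith

theorem Admissible.criticalEigenvalue_pos (hP : P.Admissible) (h : P.threshold < s) :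
    0 < P.criticalEigenvalue s := by
  have h1 := Real.rpow_lt_rpow hP.U₁_pos.le (hP.lt_div_U₁_iff.2 h) hP.δ_pos
  have h2 := mul_lt_mul_of_pos_left h1 hP.μk₃_pos
  rw [hP.mul_U₁_rpow] at h2
  rw [criticalEigenvalue]
  linarith

theorem abs_apply_sub_le_dist {n : ℕ} (u e : Fin n → ℝ) (i : Fin n) : |u i - e i| ≤ dist u e :=
  dist_le_pi_dist u e i

/-- Decay of a quadratic Lyapunov function near the equilibrium without microbes. -/
theorem Admissible.exists_lyapunov_e₁ (hP : P.Admissible) (hs : 0 ≤ s) (h : s < P.threshold) :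
    ∃ ρ > 0, ∃ D ≥ 1, ∃ c > 0, ∀ u : Fin 3 → ℝ, dist u (P.e₁ s) ≤ ρ →
      2 * (u 0 - s / P.k₁ 0) * P.field s u 0 + D * (2 * u 1 * P.field s u 1)
        + 2 * u 2 * P.field s u 2 ≤ -c * ((u 0 - s / P.k₁ 0) ^ 2 + D * u 1 ^ 2 + u 2 ^ 2) := by
  have hlam := hP.criticalEigenvalue_neg hs h
  set m := -P.criticalEigenvalue s / 2 with hm
  have hm0 : 0 < m := by rw [hm]; linarith
  set p := s / P.k₁ 0 with hp
  have hp0 : 0 ≤ p := div_nonneg hs (hP.k₁_pos 0).le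
  obtain ⟨L, hL⟩ := hP.k₁_lipschitz
  -- The net consumption of organic matter per unit of microbes.
  set b : (Fin 3 → ℝ) → ℝ := fun u => P.δ * P.k₃ (u 2) * u 0 ^ P.δ - P.η * P.k₄ with hb
  have hbc : Continuous b := by
    have h3 := hP.continuous_k₃
    have := hP.continuous_rpow
    simp only [hb]
    fun_prop
  have hev : ∀ᶠ u in 𝓝 (P.e₁ s), P.growth u < -m ∧ |b u| < |b (P.e₁ s)| + 1 := by
    refine (hP.continuous_growth.continuousAt.eventually (gt_mem_nhds ?_)).and
      (hbc.abs.continuousAt.eventually (gt_mem_nhds (lt_add_one _)))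
    rw [growth_e₁, hm]; linarith
  obtain ⟨ρ, hρ, H⟩ := Metric.nhds_basis_closedBall.eventually_iff.1 hev
  -- Within distance `1` of `e₁` one has `u 1 ≥ -1`, so monotonicity bounds both decay rates below,
  -- without a sign condition on `u`.
  set α := P.k₁ (-1) with hα
  have hα0 : 0 < α := hP.k₁_pos _
  set κ := P.k₂ (-1) with hκ
  have hκ0 : 0 < κ := hP.k₂_pos _
  set C := L * p + (|b (P.e₁ s)| + 1) with hC
  have hC0 : 0 < C := by positivity
  -- `C` bounds the coupling of `u 1` into the first equation. By Young's inequality it costs `C ^ 2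
  -- / α = (D - 1) * m` times `u 1 ^ 2`, which the weighted microbe decay `2 * D * m` absorbs,
  -- leaving at least `D * m`.
  set D := 1 + C ^ 2 / (α * m) with hD
  have hD1 : 1 ≤ D := by rw [hD]; linarith [show 0 ≤ C ^ 2 / (α * m) by positivity]
  refine ⟨min ρ 1, lt_min hρ one_pos, D, hD1, min α (min m κ), lt_min hα0 (lt_min hm0 hκ0),
    fun u hu => ?_⟩
  obtain ⟨hg, hbu⟩ := H (Metric.mem_closedBall.2 (hu.trans (min_le_left _ _)))
  have hy1 : -1 ≤ u 1 := by
    have := (abs_apply_sub_le_dist u (P.e₁ s) 1).trans (hu.trans (min_le_right _ _))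
    have h1 : P.e₁ s 1 = 0 := rfl
    rw [h1, sub_zero] at this
    exact (abs_le.1 this).1
  set x := u 0 - p with hx
  set y := u 1 with hy
  set z := u 2 with hz
  have hkα : α ≤ P.k₁ y := hP.k₁_strictMono.monotone hy1
  have hkκ : κ ≤ P.k₂ y := hP.k₂_strictMono.monotone hy1
  have hF0 : P.field s u 0 = -P.k₁ y * x - ((P.k₁ y - P.k₁ 0) * p + y * b u) := by
    have hk : P.k₁ 0 * p = s := mul_div_cancel₀ _ (hP.k₁_pos 0).ne'
    rw [field_zero, hx, hb]
    linear_combination -hk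
  have hrest : |(P.k₁ y - P.k₁ 0) * p + y * b u| ≤ C * |y| := by
    have hk : |P.k₁ y - P.k₁ 0| ≤ L * |y| := by
      simpa [Real.dist_eq] using hL.dist_le_mul y 0
    calc _ ≤ |P.k₁ y - P.k₁ 0| * p + |y| * |b u| := by
          refine (abs_add_le _ _).trans ?_
          rw [abs_mul, abs_mul, abs_of_nonneg hp0]
      _ ≤ L * |y| * p + |y| * (|b (P.e₁ s)| + 1) := by gcongr
      _ = _ := by rw [hC]; ring
  have hx0 : 2 * x * P.field s u 0 ≤ -α * x ^ 2 + C ^ 2 / α * y ^ 2 := by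
    have h1 : -(x * ((P.k₁ y - P.k₁ 0) * p + y * b u)) ≤ |x| * (C * |y|) := by
      refine (neg_le_abs _).trans ?_
      rw [abs_mul]
      gcongr
    have h2 : α * x ^ 2 ≤ P.k₁ y * x ^ 2 := by gcongr
    have h3 : 2 * (|x| * (C * |y|)) ≤ α * x ^ 2 + C ^ 2 / α * y ^ 2 := by
      have h4 : 0 ≤ (α * |x| - C * |y|) ^ 2 / α := by positivity
      have h5 : (α * |x| - C * |y|) ^ 2 / α = α * |x| ^ 2 - 2 * (|x| * (C * |y|)) + C ^ 2 / α * |y| ^ 2 := by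
        field_simp
        ring
      rw [h5, sq_abs, sq_abs] at h4
      linarith
    rw [hF0]
    linarith
  have hCD : C ^ 2 / α = (D - 1) * m := by
    rw [hD]; field_simp; ring
  have hy0 : D * (2 * y * P.field s u 1) ≤ -2 * (D * m) * y ^ 2 := by
    rw [field_one_eq]
    have : P.growth u * y ^ 2 ≤ -m * y ^ 2 := by gcongr
    have := mul_le_mul_of_nonneg_left this (zero_le_one.trans hD1)
    linarith
  have hz0 : 2 * z * P.field s u 2 ≤ -2 * κ * z ^ 2 := by
    rw [field_two]
    have : κ * z ^ 2 ≤ P.k₂ y * z ^ 2 := by gcongr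
    linarith
  have c1 : min α (min m κ) * x ^ 2 ≤ α * x ^ 2 := by gcongr; exact min_le_left _ _
  have c2 : min α (min m κ) * (D * y ^ 2) ≤ m * (D * y ^ 2) := by
    gcongr; exact (min_le_right _ _).trans (min_le_left _ _)
  have c3 : min α (min m κ) * z ^ 2 ≤ κ * z ^ 2 := by
    gcongr; exact (min_le_right _ _).trans (min_le_right _ _)
  rw [hCD] at hx0
  have c4 : 0 ≤ m * y ^ 2 := by positivity
  have c5 : 0 ≤ κ * z ^ 2 := by positivity
  linarith

/-- Gronwall for the quadratic function. The radius may be shrunk because, on the whole space, the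
ball must also stay in `0 ≤ u 0`, where the Lipschitz estimate is available. -/
theorem Admissible.exists_exponentiallyStableWithin_e₁ (hP : P.Admissible) (hs : 0 ≤ s)
    (h : s < P.threshold) (S : Set (Fin 3 → ℝ)) :
    ∃ ρ₀ > 0, ∀ ρ ≤ ρ₀, ExponentiallyStableWithin (P.field s) S (P.e₁ s) ρ := by
  obtain ⟨ρ₀, hρ₀, D, hD, c, hc, H⟩ := hP.exists_lyapunov_e₁ hs h
  refine ⟨ρ₀, hρ₀, fun ρ hρ => ⟨2 + D, by linarith, c, hc, fun T hT u hu hd t ht => ?_⟩⟩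
  have h0 : P.e₁ s 0 = s / P.k₁ 0 := rfl
  have h1 : P.e₁ s 1 = 0 := rfl
  have h2 : P.e₁ s 2 = 0 := rfl
  set V : ℝ → ℝ := fun t => (u t 0 - s / P.k₁ 0) ^ 2 + D * u t 1 ^ 2 + u t 2 ^ 2 with hV
  have hderiv : ∀ t ∈ Icc 0 T, HasDerivWithinAt V
      (2 * (u t 0 - s / P.k₁ 0) * P.field s (u t) 0 + D * (2 * u t 1 * P.field s (u t) 1)
        + 2 * u t 2 * P.field s (u t) 2) (Icc 0 T) t := by
    intro t ht
    have d0 := ((hu.hasDerivWithinAt_apply ht 0).sub_const (s / P.k₁ 0)).fun_pow 2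
    have d1 := ((hu.hasDerivWithinAt_apply ht 1).fun_pow 2).const_mul D
    have d2 := (hu.hasDerivWithinAt_apply ht 2).fun_pow 2
    refine ((d0.add d1).add d2).congr_deriv ?_
    simp
  have hdecay := le_mul_exp_of_hasDerivWithinAt_le hderiv
    (fun t ht => H (u t) ((hd t ht).trans hρ)) t ht
  have hlow : dist (u t) (P.e₁ s) ^ 2 ≤ V t := by
    have hV0 : 0 ≤ V t := by simp only [hV]; positivity
    rw [← Real.le_sqrt dist_nonneg hV0]
    refine (dist_pi_le_iff (Real.sqrt_nonneg _)).2 fun i => Real.abs_le_sqrt ?_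
    have q0 := sq_nonneg (u t 0 - s / P.k₁ 0)
    have q1 := sq_nonneg (u t 1)
    have q2 := sq_nonneg (u t 2)
    have q3 : u t 1 ^ 2 ≤ D * u t 1 ^ 2 := le_mul_of_one_le_left q1 hD
    fin_cases i <;> simp only [Fin.zero_eta, Fin.mk_one, Fin.reduceFinMk, h0, h1, h2, sub_zero, hV] <;>
      linarith
  have hup : V 0 ≤ (2 + D) * dist (u 0) (P.e₁ s) ^ 2 := by
    have a0 := abs_apply_sub_le_dist (u 0) (P.e₁ s) 0
    have a1 := abs_apply_sub_le_dist (u 0) (P.e₁ s) 1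
    have a2 := abs_apply_sub_le_dist (u 0) (P.e₁ s) 2
    rw [h0] at a0
    rw [h1, sub_zero] at a1
    rw [h2, sub_zero] at a2
    have b0 := pow_le_pow_left₀ (abs_nonneg _) a0 2
    have b1 := pow_le_pow_left₀ (abs_nonneg _) a1 2
    have b2 := pow_le_pow_left₀ (abs_nonneg _) a2 2
    rw [sq_abs] at b0 b1 b2
    have b3 := mul_le_mul_of_nonneg_left b1 (zero_le_one.trans hD)
    simp only [hV]
    linarith
  calc _ ≤ V t := hlow
    _ ≤ _ := hdecay
    _ ≤ _ := by gcongr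

theorem Admissible.asymptoticallyStable_e₁ (hP : P.Admissible) (hs : 0 ≤ s)
    (h : s < P.threshold) : AsymptoticallyStable (P.field s) octant (P.e₁ s) := by
  obtain ⟨ρ, hρ, H⟩ := hP.exists_exponentiallyStableWithin_e₁ hs h octant
  have hst := (H ρ le_rfl).stableWithin.lyapunovStable hρ fun x hx => hP.exists_solution_octant hs hx
  exact hst.asymptoticallyStable hρ fun u hu hd r hr => (H ρ le_rfl).exists_dist_lt hu hd hr

/-- Near a point with positive first coordinate the field is Lipschitz. -/
theorem Admissible.exists_lipschitzOnWith_closedBall (hP : P.Admissible) (s : ℝ) {e : Fin 3 → ℝ}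
    {ρ : ℝ} (hρ : ρ ≤ e 0) : ∃ K, LipschitzOnWith K (P.field s) (Metric.closedBall e ρ) := by
  obtain ⟨R, hR⟩ := (Metric.isBounded_closedBall (x := e) (r := ρ)).subset_closedBall 0
  refine hP.exists_lipschitzOnWith s hR fun u hu => ?_
  have := (abs_apply_sub_le_dist u e 0).trans (Metric.mem_closedBall.1 hu)
  linarith [(abs_le.1 this).1]

theorem Admissible.asymptoticallyStable_univ_e₁ (hP : P.Admissible) (hs : 0 < s)
    (h : s < P.threshold) : AsymptoticallyStable (P.field s) univ (P.e₁ s) := by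
  obtain ⟨ρ₀, hρ₀, H⟩ := hP.exists_exponentiallyStableWithin_e₁ hs.le h univ
  have hp : 0 < s / P.k₁ 0 := div_pos hs (hP.k₁_pos 0)
  have hρ : 0 < min ρ₀ (s / P.k₁ 0) := lt_min hρ₀ hp
  have hE := H _ (min_le_left ρ₀ (s / P.k₁ 0))
  obtain ⟨K, hK⟩ := hP.exists_lipschitzOnWith_closedBall s (e := P.e₁ s)
    (min_le_right ρ₀ (s / P.k₁ 0))
  exact (hE.stableWithin.lyapunovStable_univ hρ hK).asymptoticallyStable hρ
    fun u hu hd r hr => hE.exists_dist_lt hu hd hr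

/-- A seed `r / 2` of microbes suffices: while the solution stays near `e₁`, their growth rate
exceeds half the critical eigenvalue. -/
theorem Admissible.unstable_e₁ (hP : P.Admissible) (h : P.threshold < s) :
    Unstable (P.field s) octant (P.e₁ s) := by
  have hs : 0 < s := hP.threshold_pos.trans h
  have hlam := hP.criticalEigenvalue_pos h
  set m := P.criticalEigenvalue s / 2 with hm
  have hm0 : 0 < m := half_pos hlam
  have hev : ∀ᶠ u in 𝓝 (P.e₁ s), m < P.growth u := by
    refine hP.continuous_growth.continuousAt.eventually (lt_mem_nhds ?_)
    rw [growth_e₁]; exact half_lt_self hlam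
  obtain ⟨ρ, hρ, H⟩ := Metric.eventually_nhds_iff.1 hev
  refine ⟨ρ, hρ, fun r hr => ?_⟩
  set x : Fin 3 → ℝ := ![s / P.k₁ 0, r / 2, 0] with hx
  have hxo : x ∈ octant := by
    have := div_nonneg hs.le (hP.k₁_pos 0).le
    intro i
    have := half_pos hr
    fin_cases i <;> simp [hx] <;> linarith
  obtain ⟨u, hu, hu0⟩ := hP.exists_solution_octant hs.le hxo
  have hdist : dist (u 0) (P.e₁ s) < r := by
    rw [hu0]
    refine (dist_pi_lt_iff hr).2 fun i => ?_
    fin_cases i <;> simp [hx, e₁, hr, abs_of_pos]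
  suffices ∃ T ≥ 0, ρ ≤ dist (u T) (P.e₁ s) by
    obtain ⟨T, hT, hTρ⟩ := this
    exact ⟨T, hT, u, hu.mono Icc_subset_Ici_self, hdist, hTρ⟩
  by_contra! hcon
  -- Chosen so that the linear lower bound `r / 2 * (1 + m * T)` for the exponential already exceeds
  -- `ρ`.
  set T := ρ / (r / 2 * m) with hTdef
  have hT : 0 ≤ T := by positivity
  have huT := hu.mono (show Icc 0 T ⊆ Ici 0 from Icc_subset_Ici_self)
  have hgrow := le_mul_exp_of_hasDerivWithinAt_le (φ := fun t => -u t 1) (c := -m)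
    (fun t ht => (huT.hasDerivWithinAt_apply ht 1).fun_neg) (fun t ht => ?_) T ⟨hT, le_rfl⟩
  · have hx1 : u 0 1 = r / 2 := by rw [hu0]; rfl
    rw [hx1, neg_neg] at hgrow
    have h1 : u T 1 < ρ := by
      have := (abs_apply_sub_le_dist (u T) (P.e₁ s) 1).trans_lt (hcon T hT)
      have h1 : P.e₁ s 1 = 0 := rfl
      rw [h1, sub_zero] at this
      exact (abs_lt.1 this).2
    have h2 : r / 2 * (m * T + 1) ≤ r / 2 * Real.exp (m * T) := by
      gcongr; exact Real.add_one_le_exp _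
    have h3 : r / 2 * (m * T) = ρ := by rw [hTdef]; field_simp
    linarith
  · have hg := H (hcon t ht.1)
    have hy : 0 ≤ u t 1 := (huT t ht).1 1
    rw [field_one_eq]
    have := mul_le_mul_of_nonneg_right hg.le hy
    linarith

set_option maxHeartbeats 1000000 in
/-- At the threshold the equilibrium without microbes is stable in the octant. -/
theorem Admissible.stableWithin_e₁_threshold (hP : P.Admissible) :
    StableWithin (P.field P.threshold) octant (P.e₁ P.threshold) 1 := by
  have hU := hP.U₁_pos
  have hδ := hP.δ_pos
  have hk1 := hP.k₁_pos 0
  have hk3 := hP.k₃_pos 0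
  have h0 : P.e₁ P.threshold 0 = P.U₁ := mul_div_cancel_left₀ _ hk1.ne'
  have h1 : P.e₁ P.threshold 1 = 0 := rfl
  have h2 : P.e₁ P.threshold 2 = 0 := rfl
  obtain ⟨L₁, hL₁⟩ := hP.k₁_lipschitz
  obtain ⟨L₃, hL₃⟩ := hP.k₃_lipschitz
  obtain ⟨B, hB0, -, hB⟩ := boundedLipschitzOn_rpow hP.one_le_δ (P.U₁ + 1)
  set κ := min (P.k₁ 0) (P.k₂ 0) with hκ
  have hκ0 : 0 < κ := lt_min hk1 (hP.k₂_pos 0)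
  have hUp : 0 < P.U₁ ^ P.δ := Real.rpow_pos_of_pos hU _
  -- With `q = r * exp (-κ t)` bounding the excess of `u 0` over `U₁` and the charcoal, the growth
  -- rate is at most `C * q`. Its time integral is at most `C / κ`, whence the amplification factor
  -- `Y`. The constant `C'` bounds the drain on `u 0` per unit of microbes when `u 0 ≤ U₁` and `u 2
  -- ≤ 1`; `N` adds up all deviations relative to `r`.
  have hμ := hP.μ_pos
  set C := P.μ * (L₃ * P.U₁ ^ P.δ + P.k₃ 0 * B + L₃ * B) with hC
  have hC0 : 0 ≤ C := by positivity
  set Y := Real.exp (C / κ) with hY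
  set C' := L₁ * P.U₁ + P.δ * P.k₃ 1 * P.U₁ ^ P.δ with hC'
  have hC'0 : 0 ≤ C' := by have := hP.k₃_pos 1; positivity
  set N := 1 + Y + C' * Y / P.k₁ 0 with hN
  have hY0 : 0 < Y := Real.exp_pos _
  have hCY : 0 ≤ C' * Y / P.k₁ 0 := by positivity
  have hN0 : 0 < N := by positivity
  intro ε hε
  set r := min 1 (ε / (2 * N)) with hr
  have hr0 : 0 < r := lt_min one_pos (by positivity)
  have hr1 : r ≤ 1 := min_le_left _ _
  have hrN : r * N < ε := by
    have : r * N ≤ ε / (2 * N) * N := by gcongr; exact min_le_right _ _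
    have h4 : ε / (2 * N) * N = ε / 2 := by field_simp
    linarith
  refine ⟨r, hr0, fun T hT u hu hd hu0 => ?_⟩
  have hpos : ∀ t ∈ Icc 0 T, ∀ i, 0 ≤ u t i := fun t ht => (hu t ht).1
  have i0 := (abs_lt.1 ((abs_apply_sub_le_dist (u 0) (P.e₁ P.threshold) 0).trans_lt hu0))
  have i1 := (abs_lt.1 ((abs_apply_sub_le_dist (u 0) (P.e₁ P.threshold) 1).trans_lt hu0))
  have i2 := (abs_lt.1 ((abs_apply_sub_le_dist (u 0) (P.e₁ P.threshold) 2).trans_lt hu0))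
  rw [h0] at i0
  rw [h1, sub_zero] at i1
  rw [h2, sub_zero] at i2
  have hthr : P.threshold = P.k₁ 0 * P.U₁ := rfl
  -- This is `ημ ≤ δ`: above `U₁`, microbes consume at least as much organic matter as they return.
  -- Hence the excess of `u 0` decays in `hx` whatever the microbes do.
  have hdδ : P.η * P.k₄ ≤ P.δ * P.k₃ 0 * P.U₁ ^ P.δ := by
    have h3 : P.δ * P.k₃ 0 * P.U₁ ^ P.δ = P.δ * (P.k₄ / P.μ) := by
      rw [hP.U₁_rpow]; field_simp
    rw [h3, mul_div_assoc', le_div_iff₀ hμ]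
    have := mul_le_mul_of_nonneg_right hP.ημ_le_δ hP.k₄_pos.le
    linarith
  have conv : ∀ a t : ℝ, a * Real.exp (κ * t) ≤ r → a ≤ r * Real.exp (-κ * t) := by
    intro a t h
    have h3 : a * Real.exp (κ * t) * Real.exp (-κ * t) ≤ r * Real.exp (-κ * t) := by gcongr
    rwa [mul_assoc, ← Real.exp_add, ← add_mul, add_neg_cancel, zero_mul, Real.exp_zero, mul_one] at h3
  have hx : ∀ t ∈ Icc 0 T, u t 0 - P.U₁ ≤ r * Real.exp (-κ * t) := by
    intro t ht
    refine conv _ _ (le_of_hasDerivWithinAt_nonpos_above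
      (φ := fun t => (u t 0 - P.U₁) * Real.exp (κ * t)) (fun t ht => hasDerivWithinAt_mul_exp
        ((hu.hasDerivWithinAt_apply ht 0).sub_const P.U₁)) (fun t ht hlt => ?_) ?_ t ht)
    · have hxpos : 0 < u t 0 - P.U₁ := by
        by_contra! hle
        exact absurd (mul_nonpos_of_nonpos_of_nonneg hle (Real.exp_pos (κ * t)).le)
          (not_le.2 (hr0.trans hlt))
      refine mul_nonpos_of_nonpos_of_nonneg ?_ (Real.exp_pos _).le
      have hy := hpos t ht 1
      have hz := hpos t ht 2
      have a1 : P.k₁ 0 ≤ P.k₁ (u t 1) := hP.k₁_strictMono.monotone hy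
      have a3 : P.k₃ 0 ≤ P.k₃ (u t 2) := hP.k₃_strictMono.monotone hz
      have ap : P.U₁ ^ P.δ ≤ u t 0 ^ P.δ := Real.rpow_le_rpow hU.le (by linarith) hδ.le
      have a4 : P.k₃ 0 * P.U₁ ^ P.δ ≤ P.k₃ (u t 2) * u t 0 ^ P.δ :=
        mul_le_mul a3 ap hUp.le (hP.k₃_pos _).le
      have a5 := mul_le_mul_of_nonneg_right (hdδ.trans_eq (mul_assoc _ _ _)) hy
      have a6 := mul_le_mul_of_nonneg_right (mul_le_mul_of_nonneg_left a4 hδ.le) hy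
      have a7 := mul_le_mul_of_nonneg_right a1 (hpos t ht 0)
      have a8 : κ * (u t 0 - P.U₁) ≤ P.k₁ 0 * (u t 0 - P.U₁) := by
        gcongr; exact min_le_left _ _
      rw [field_zero, hthr]
      linarith
    · simp only [mul_zero, Real.exp_zero, mul_one]; linarith
  have hz : ∀ t ∈ Icc 0 T, u t 2 ≤ r * Real.exp (-κ * t) := by
    intro t ht
    refine (le_mul_exp_of_hasDerivWithinAt_le (c := κ)
      (fun t ht => hu.hasDerivWithinAt_apply ht 2) (fun t ht => ?_) t ht).trans ?_
    · have a2 : P.k₂ 0 ≤ P.k₂ (u t 1) := hP.k₂_strictMono.monotone (hpos t ht 1)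
      have := mul_le_mul_of_nonneg_right ((min_le_right _ _ : κ ≤ _).trans a2) (hpos t ht 2)
      rw [field_two]
      linarith
    · gcongr; linarith
  have hE1 : ∀ t ∈ Icc 0 T, r * Real.exp (-κ * t) ≤ 1 := by
    intro t ht
    have : Real.exp (-κ * t) ≤ 1 := Real.exp_le_one_iff.2 (by nlinarith [ht.1])
    calc _ ≤ (1 : ℝ) * 1 := by gcongr
      _ = 1 := one_mul 1
  have hgrowth : ∀ t ∈ Icc 0 T, P.growth (u t) ≤ C * (r * Real.exp (-κ * t)) := by
    intro t ht
    set q := r * Real.exp (-κ * t) with hq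
    have hq0 : 0 ≤ q := by positivity
    have hq1 := hE1 t ht
    have g3 : P.k₃ (u t 2) ≤ P.k₃ 0 + L₃ * q := by
      have := (le_abs_self _).trans (hL₃.dist_le_mul q 0)
      rw [Real.dist_eq, sub_zero, abs_of_nonneg hq0] at this
      linarith [hP.k₃_strictMono.monotone (hz t ht)]
    have gp : u t 0 ^ P.δ ≤ P.U₁ ^ P.δ + B * q := by
      have := (le_abs_self _).trans (hB (P.U₁ + q) ⟨by positivity, by linarith⟩ P.U₁
        ⟨hU.le, by linarith⟩)
      rw [Real.dist_eq, add_sub_cancel_left, abs_of_nonneg hq0] at this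
      have := Real.rpow_le_rpow (hpos t ht 0) (show u t 0 ≤ P.U₁ + q by linarith [hx t ht]) hδ.le
      linarith
    have g4 : P.k₃ (u t 2) * u t 0 ^ P.δ ≤ (P.k₃ 0 + L₃ * q) * (P.U₁ ^ P.δ + B * q) :=
      mul_le_mul g3 gp (Real.rpow_nonneg (hpos t ht 0) _) (by positivity)
    have g5 : (L₃ * B) * (q * q) ≤ (L₃ * B) * (q * 1) := by gcongr
    have g6 : P.k₃ (u t 2) * u t 0 ^ P.δ ≤ P.k₃ 0 * P.U₁ ^ P.δ
        + (L₃ * P.U₁ ^ P.δ + P.k₃ 0 * B + L₃ * B) * q := by linarith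
    have g7 := mul_le_mul_of_nonneg_left g6 hμ.le
    have := hP.mul_U₁_rpow
    rw [growth, hC]
    linarith
  have hy : ∀ t ∈ Icc 0 T, u t 1 ≤ r * Y := by
    intro t ht
    -- The integrating factor has logarithmic derivative `-C * r * exp (-κ t)`, which compensates
    -- the bound on the growth rate.
    have hanti := antitoneOn_Icc_of_hasDerivWithinAt (a := 0) (b := T)
      (φ := fun t => u t 1 * Real.exp (C / κ * (r * Real.exp (-κ * t))))
      (fun t ht => (hu.hasDerivWithinAt_apply ht 1).mul
        (((((hasDerivWithinAt_id t (Icc 0 T)).const_mul (-κ)).exp.const_mul r).const_mul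
          (C / κ)).exp)) (fun t ht => ?_)
    · have h3 := hanti ⟨le_rfl, hT⟩ ht ht.1
      simp only [mul_zero, Real.exp_zero, mul_one] at h3
      have h4 : u t 1 ≤ u t 1 * Real.exp (C / κ * (r * Real.exp (-κ * t))) :=
        le_mul_of_one_le_right (hpos t ht 1) (Real.one_le_exp (by positivity))
      have h5 : u 0 1 * Real.exp (C / κ * r) ≤ r * Y := by
        rw [hY]
        gcongr
        · exact i1.2.le
        · exact mul_le_of_le_one_right (by positivity) hr1
      linarith
    · have ht' := Ioo_subset_Icc_self ht
      have g := mul_le_mul_of_nonneg_right (hgrowth t ht') (hpos t ht' 1)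
      rw [field_one_eq]
      have hid : P.growth (u t) * u t 1 * Real.exp (C / κ * (r * Real.exp (-κ * id t))) +
          u t 1 * (Real.exp (C / κ * (r * Real.exp (-κ * id t))) *
            (C / κ * (r * (Real.exp (-κ * id t) * (-κ * 1))))) =
          (P.growth (u t) * u t 1 - C * (r * Real.exp (-κ * t)) * u t 1) *
            Real.exp (C / κ * (r * Real.exp (-κ * id t))) := by
        simp only [id]
        field_simp
        ring
      refine hid.trans_le (mul_nonpos_of_nonpos_of_nonneg (by linarith) (Real.exp_pos _).le)
  -- A barrier: at a larger deficit the restoring term is at least `k₁ 0 * r + C' * (r * Y)`, more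
  -- than the drain `C' * u 1`.
  have hxlow : ∀ t ∈ Icc 0 T, -(u t 0 - P.U₁) ≤ r * (1 + C' * Y / P.k₁ 0) := by
    refine le_of_hasDerivWithinAt_nonpos_above (fun t ht =>
      ((hu.hasDerivWithinAt_apply ht 0).sub_const P.U₁).fun_neg) (fun t ht hlt => ?_) ?_
    · have hy0 := hpos t ht 1
      have hy1 := hy t ht
      have hzero := hpos t ht 2
      have hz1 : u t 2 ≤ 1 := (hz t ht).trans (hE1 t ht)
      have hneg : 0 ≤ -(u t 0 - P.U₁) := by
        have : 0 ≤ r * (1 + C' * Y / P.k₁ 0) := by positivity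
        linarith
      have b1 : P.k₁ (u t 1) - P.k₁ 0 ≤ L₁ * u t 1 := by
        have := (le_abs_self _).trans (hL₁.dist_le_mul (u t 1) 0)
        rwa [Real.dist_eq, sub_zero, abs_of_nonneg hy0] at this
      have b2 := mul_le_mul_of_nonneg_right b1 hU.le
      have b3 : P.k₃ (u t 2) * u t 0 ^ P.δ ≤ P.k₃ 1 * P.U₁ ^ P.δ :=
        mul_le_mul (hP.k₃_strictMono.monotone hz1)
          (Real.rpow_le_rpow (hpos t ht 0) (by linarith) hδ.le)
          (Real.rpow_nonneg (hpos t ht 0) _) (hP.k₃_pos 1).le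
      have b4 := mul_le_mul_of_nonneg_right (mul_le_mul_of_nonneg_left b3 hδ.le) hy0
      have b5 : P.k₁ 0 * -(u t 0 - P.U₁) ≤ P.k₁ (u t 1) * -(u t 0 - P.U₁) :=
        mul_le_mul_of_nonneg_right (hP.k₁_strictMono.monotone hy0) hneg
      have b6 : P.k₁ 0 * (r * (1 + C' * Y / P.k₁ 0)) ≤ P.k₁ 0 * -(u t 0 - P.U₁) := by gcongr
      have b7 : P.k₁ 0 * (r * (1 + C' * Y / P.k₁ 0)) = P.k₁ 0 * r + C' * (r * Y) := by
        field_simp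
      have b8 : C' * u t 1 ≤ C' * (r * Y) := by gcongr
      have b9 := mul_nonneg (mul_nonneg hP.η_pos.le hP.k₄_pos.le) hy0
      have b10 : C' * u t 1 = L₁ * u t 1 * P.U₁ + P.δ * (P.k₃ 1 * P.U₁ ^ P.δ) * u t 1 := by
        rw [hC']; ring
      have b11 := mul_pos hk1 hr0
      rw [field_zero, hthr]
      linarith
    · have : 0 ≤ r * (C' * Y / P.k₁ 0) := by positivity
      linarith
  intro t ht
  have hrY : 0 < r * Y := by positivity
  have hrC : 0 ≤ r * (C' * Y / P.k₁ 0) := by positivity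
  have hexp : r * Real.exp (-κ * t) ≤ r :=
    mul_le_of_le_one_right hr0.le (Real.exp_le_one_iff.2 (by nlinarith [ht.1]))
  have hNe : r * N = r + r * Y + r * (C' * Y / P.k₁ 0) := by rw [hN]; ring
  refine (dist_pi_lt_iff hε).2 fun i => ?_
  rw [Real.dist_eq, abs_lt]
  have j0 := hx t ht
  have j1 := hxlow t ht
  have j2 := hy t ht
  have j3 := hz t ht
  have j4 := hpos t ht 1
  have j5 := hpos t ht 2
  fin_cases i
  · simp only [Fin.zero_eta, h0]
    constructor <;> linarith
  · simp only [Fin.mk_one, h1, sub_zero]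
    constructor <;> linarith
  · simp only [Fin.reduceFinMk, h2, sub_zero]
    constructor <;> linarith

theorem Admissible.lyapunovStable_e₁_threshold (hP : P.Admissible) :
    LyapunovStable (P.field P.threshold) octant (P.e₁ P.threshold) :=
  hP.stableWithin_e₁_threshold.lyapunovStable one_pos
    fun _ hx => hP.exists_solution_octant hP.threshold_pos.le hx

end SoilModel

/-! ### Potentials -/

section Potential

variable {g : ℝ → ℝ} {a : ℝ}

/-- The potential of a force `-g` that points towards `a`. -/
def potential (g : ℝ → ℝ) (a x : ℝ) : ℝ := ∫ y in a..x, g y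

theorem potential_self : potential g a a = 0 := intervalIntegral.integral_same

theorem hasDerivAt_potential (hg : Continuous g) (x : ℝ) :
    HasDerivAt (potential g a) (g x) x :=
  intervalIntegral.integral_hasDerivAt_right (hg.intervalIntegrable _ _)
    (hg.stronglyMeasurableAtFilter _ _) hg.continuousAt

theorem continuous_potential (hg : Continuous g) : Continuous (potential g a) :=
  continuous_iff_continuousAt.2 fun x => (hasDerivAt_potential hg x).continuousAt

theorem strictMonoOn_potential (hg : Continuous g) (h : ∀ x, a < x → 0 < g x) :
    StrictMonoOn (potential g a) (Ici a) := by
  refine strictMonoOn_of_deriv_pos (convex_Ici a) (continuous_potential hg).continuousOn ?_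
  intro x hx
  rw [interior_Ici] at hx
  rw [(hasDerivAt_potential hg x).deriv]
  exact h x hx

theorem strictAntiOn_potential (hg : Continuous g) (h : ∀ x, x < a → g x < 0) :
    StrictAntiOn (potential g a) (Iic a) := by
  refine strictAntiOn_of_deriv_neg (convex_Iic a) (continuous_potential hg).continuousOn ?_
  intro x hx
  rw [interior_Iic] at hx
  rw [(hasDerivAt_potential hg x).deriv]
  exact h x hx

theorem potential_nonneg (hg : Continuous g) (h : ∀ x, a < x → 0 < g x)
    (h' : ∀ x, x < a → g x < 0) (x : ℝ) : 0 ≤ potential g a x := by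
  rw [← potential_self (g := g) (a := a)]
  rcases le_total a x with hx | hx
  · exact (strictMonoOn_potential hg h).monotoneOn self_mem_Ici hx hx
  · exact (strictAntiOn_potential hg h').antitoneOn hx self_mem_Iic hx

/-- The potential increases strictly away from `a` on both sides, so the smaller of its values at `a
- ε` and `a + ε` serves as `η`. -/
theorem exists_abs_sub_lt_of_potential_lt (hg : Continuous g) (h : ∀ x, a < x → 0 < g x)
    (h' : ∀ x, x < a → g x < 0) {ε : ℝ} (hε : 0 < ε) :
    ∃ η > 0, ∀ x, potential g a x < η → |x - a| < ε := by
  have hm := strictMonoOn_potential hg h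
  have hn := strictAntiOn_potential hg h'
  have hr : a + ε ∈ Ici a := by simpa using hε.le
  have hl : a - ε ∈ Iic a := by simpa using hε.le
  refine ⟨min (potential g a (a - ε)) (potential g a (a + ε)), lt_min ?_ ?_, fun x hx => ?_⟩
  · simpa [potential_self] using hn hl self_mem_Iic (by linarith)
  · simpa [potential_self] using hm self_mem_Ici hr (by linarith)
  · rw [abs_lt]
    constructor
    · by_contra! hle
      have := hn.antitoneOn (show x ∈ Iic a by simp only [mem_Iic]; linarith) hl (by linarith)
      exact absurd (hx.trans_le (min_le_left _ _)) (not_lt.2 this)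
    · by_contra! hle
      have := hm.monotoneOn hr (show x ∈ Ici a by simp only [mem_Ici]; linarith) (by linarith)
      exact absurd (hx.trans_le (min_le_right _ _)) (not_lt.2 this)

end Potential

/-- With `c ^ p = c * c ^ (p - 1)`, the difference of the two sides is `a * (a - b) * (a ^ (p - 1) -
b ^ (p - 1))`, a product of equal signs. It makes the dissipation at `e₂` quadratic in `u 0 - U₁`.
-/
theorem rpow_sub_rpow_mul_sub_ge {a b p : ℝ} (ha : 0 < a) (hb : 0 < b) (hp : 1 ≤ p) :
    b ^ (p - 1) * (a - b) ^ 2 ≤ (a - b) * (a ^ p - b ^ p) := by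
  have h1 : ∀ c : ℝ, 0 < c → c ^ p = c * c ^ (p - 1) := fun c hc => by
    rw [Real.rpow_sub_one hc.ne', mul_div_cancel₀ _ hc.ne']
  have h2 : 0 ≤ (a - b) * (a ^ (p - 1) - b ^ (p - 1)) := by
    rcases le_total a b with h | h
    · exact mul_nonneg_of_nonpos_of_nonpos (sub_nonpos.2 h)
        (sub_nonpos.2 (Real.rpow_le_rpow ha.le h (by linarith)))
    · exact mul_nonneg (sub_nonneg.2 h)
        (sub_nonneg.2 (Real.rpow_le_rpow hb.le h (by linarith)))
  rw [h1 a ha, h1 b hb]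
  have h3 := mul_nonneg ha.le h2
  linarith

namespace SoilModel

variable {P : SoilModel} {s v : ℝ}

/-! ### The equilibrium with microbes -/

/-- The growth rate of the microbes in the absence of charcoal. -/
def baseGrowth (P : SoilModel) (x : ℝ) : ℝ := P.μ * P.k₃ 0 * (max x 0) ^ P.δ - P.k₄

theorem Admissible.continuous_baseGrowth (hP : P.Admissible) : Continuous P.baseGrowth := by
  have : Continuous fun x : ℝ => (max x 0) ^ P.δ :=
    (continuous_id.max continuous_const).rpow_const fun _ => Or.inr hP.δ_pos.le
  unfold baseGrowth
  fun_prop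

theorem baseGrowth_of_nonneg {x : ℝ} (hx : 0 ≤ x) :
    P.baseGrowth x = P.μ * P.k₃ 0 * x ^ P.δ - P.k₄ := by
  rw [baseGrowth, max_eq_left hx]

theorem Admissible.baseGrowth_eq (hP : P.Admissible) {x : ℝ} (hx : 0 ≤ x) :
    P.baseGrowth x = P.μ * P.k₃ 0 * (x ^ P.δ - P.U₁ ^ P.δ) := by
  rw [baseGrowth_of_nonneg hx]
  linear_combination hP.mul_U₁_rpow

theorem Admissible.baseGrowth_pos (hP : P.Admissible) {x : ℝ} (hx : P.U₁ < x) :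
    0 < P.baseGrowth x := by
  rw [hP.baseGrowth_eq (hP.U₁_pos.trans hx).le]
  exact mul_pos hP.μk₃_pos (sub_pos.2 (Real.rpow_lt_rpow hP.U₁_pos.le hx hP.δ_pos))

/-- The truncation `max x 0` extends the sign to negative `x`, so the potential has its strict
minimum at `U₁` on the whole line. -/
theorem Admissible.baseGrowth_neg (hP : P.Admissible) {x : ℝ} (hx : x < P.U₁) :
    P.baseGrowth x < 0 := by
  have h : (max x 0) ^ P.δ < P.U₁ ^ P.δ :=
    Real.rpow_lt_rpow (le_max_right _ _) (max_lt hx hP.U₁_pos) hP.δ_pos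
  have := mul_lt_mul_of_pos_left h hP.μk₃_pos
  rw [hP.mul_U₁_rpow] at this
  rw [baseGrowth]
  linarith

/-- The relative deficit of `u₁`-production; the denominator is kept away from zero. -/
def deficit (P : SoilModel) (s v w : ℝ) : ℝ := -P.surplus s w / max w (v / 2)

theorem Admissible.continuous_deficit (hP : P.Admissible) (hv : 0 < v) :
    Continuous (P.deficit s v) := by
  have h : ∀ w, max w (v / 2) ≠ 0 := fun w => (lt_max_of_lt_right (half_pos hv)).ne'
  have hs := hP.continuous_surplus (s := s)
  unfold deficit
  exact hs.neg.div (continuous_id.max continuous_const) h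

theorem Admissible.deficit_pos (hP : P.Admissible) (hv : 0 < v) (hv' : P.surplus s v = 0) {w : ℝ}
    (hw : v < w) : 0 < P.deficit s v w := by
  have := hP.surplus_strictAnti (s := s) hw
  exact div_pos (by linarith) (lt_max_of_lt_right (half_pos hv))

theorem Admissible.deficit_neg (hP : P.Admissible) (hv : 0 < v) (hv' : P.surplus s v = 0) {w : ℝ}
    (hw : w < v) : P.deficit s v w < 0 := by
  have := hP.surplus_strictAnti (s := s) hw
  exact div_neg_of_neg_of_pos (by linarith) (lt_max_of_lt_right (half_pos hv))

theorem Admissible.surplus_mul_nonpos (hP : P.Admissible) (hv' : P.surplus s v = 0) (w : ℝ) :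
    P.surplus s w * (w - v) ≤ 0 := by
  rcases le_total v w with h | h
  · have := (hP.surplus_strictAnti (s := s)).antitone h
    exact mul_nonpos_of_nonpos_of_nonneg (by linarith) (by linarith)
  · have := (hP.surplus_strictAnti (s := s)).antitone h
    exact mul_nonpos_of_nonneg_of_nonpos (by linarith) (by linarith)

/-- The Lyapunov function of the subsystem without charcoal. -/
def lyapunov (P : SoilModel) (s v : ℝ) (u : Fin 3 → ℝ) : ℝ :=
  potential P.baseGrowth P.U₁ (u 0) + potential (P.deficit s v) v (u 1)

/-- The derivative of the Lyapunov function along the field. -/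
def lyapunovDeriv (P : SoilModel) (s v : ℝ) (u : Fin 3 → ℝ) : ℝ :=
  P.baseGrowth (u 0) * P.field s u 0 + P.deficit s v (u 1) * P.field s u 1

/-- A radius on which `(U₁, v, 0)` has a neighbourhood with positive first coordinates. -/
def radius (P : SoilModel) (v : ℝ) : ℝ := min (P.U₁ / 2) (v / 2)

theorem Admissible.radius_pos (hP : P.Admissible) (hv : 0 < v) : 0 < P.radius v :=
  lt_min (half_pos hP.U₁_pos) (half_pos hv)

/-- In this ball the truncations in `baseGrowth` and `deficit` are inactive. -/
theorem half_le_of_dist_le {u : Fin 3 → ℝ}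
    (hu : dist u (P.e₂ v) ≤ P.radius v) : P.U₁ / 2 ≤ u 0 ∧ v / 2 ≤ u 1 := by
  have h0 := (abs_le.1 ((abs_apply_sub_le_dist u (P.e₂ v) 0).trans
    (hu.trans (min_le_left _ _)))).1
  have h1 := (abs_le.1 ((abs_apply_sub_le_dist u (P.e₂ v) 1).trans
    (hu.trans (min_le_right _ _)))).1
  have e0 : P.e₂ v 0 = P.U₁ := rfl
  have e1 : P.e₂ v 1 = v := rfl
  rw [e0] at h0
  rw [e1] at h1
  constructor <;> linarith

theorem Admissible.lyapunov_nonneg (hP : P.Admissible) (hv : 0 < v) (hv' : P.surplus s v = 0)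
    (u : Fin 3 → ℝ) : 0 ≤ P.lyapunov s v u :=
  add_nonneg
    (potential_nonneg hP.continuous_baseGrowth (fun _ => hP.baseGrowth_pos)
      (fun _ => hP.baseGrowth_neg) _)
    (potential_nonneg (hP.continuous_deficit hv) (fun _ => hP.deficit_pos hv hv')
      (fun _ => hP.deficit_neg hv hv') _)

theorem Admissible.continuous_lyapunov (hP : P.Admissible) (hv : 0 < v) :
    Continuous (P.lyapunov s v) :=
  ((continuous_potential hP.continuous_baseGrowth).comp (continuous_apply 0)).add
    ((continuous_potential (hP.continuous_deficit hv)).comp (continuous_apply 1))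

theorem lyapunov_e₂ : P.lyapunov s v (P.e₂ v) = 0 := by
  have e0 : P.e₂ v 0 = P.U₁ := rfl
  have e1 : P.e₂ v 1 = v := rfl
  rw [lyapunov, e0, e1, potential_self, potential_self, add_zero]

theorem Admissible.hasDerivWithinAt_lyapunov (hP : P.Admissible) (hv : 0 < v)
    {S : Set (Fin 3 → ℝ)} {I : Set ℝ} {u : ℝ → Fin 3 → ℝ} (hu : IsSolutionOn (P.field s) S I u)
    {t : ℝ} (ht : t ∈ I) :
    HasDerivWithinAt (fun t => P.lyapunov s v (u t)) (P.lyapunovDeriv s v (u t)) I t := by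
  have h0 := hasDerivAt_potential (a := P.U₁) hP.continuous_baseGrowth (u t 0)
  have h1 := hasDerivAt_potential (a := v) (hP.continuous_deficit (s := s) hv) (u t 1)
  exact (h0.comp_hasDerivWithinAt t (hu.hasDerivWithinAt_apply ht 0)).add
    (h1.comp_hasDerivWithinAt t (hu.hasDerivWithinAt_apply ht 1))

theorem Admissible.field_zero_eq (hP : P.Admissible) {u : Fin 3 → ℝ} (hu : 0 ≤ u 0) :
    P.field s u 0 = P.surplus s (u 1) - P.k₁ (u 1) * (u 0 - P.U₁)
      - P.δ / P.μ * u 1 * P.baseGrowth (u 0)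
      - P.δ * (P.k₃ (u 2) - P.k₃ 0) * u 1 * u 0 ^ P.δ := by
  have := hP.μ_pos.ne'
  rw [field_zero, surplus, baseGrowth_of_nonneg hu]
  field_simp
  ring

theorem field_one_eq_baseGrowth {u : Fin 3 → ℝ} (hu : 0 ≤ u 0) :
    P.field s u 1 = u 1 * P.baseGrowth (u 0)
      + P.μ * (P.k₃ (u 2) - P.k₃ 0) * u 1 * u 0 ^ P.δ := by
  rw [field_one, baseGrowth_of_nonneg hu]
  ring

theorem exists_abs_le_closedBall {n : ℕ} {φ : (Fin n → ℝ) → ℝ} (hφ : Continuous φ)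
    (e : Fin n → ℝ) (ρ : ℝ) : ∃ C ≥ 0, ∀ u, dist u e ≤ ρ → |φ u| ≤ C := by
  obtain ⟨C, hC⟩ := (isCompact_closedBall e ρ).exists_bound_of_continuousOn hφ.continuousOn
  exact ⟨max C 0, le_max_right _ _, fun u hu => (hC u hu).trans (le_max_left _ _)⟩

/-- The Lyapunov function decreases, up to an error controlled by the charcoal. -/
theorem Admissible.exists_lyapunovDeriv_le (hP : P.Admissible) (hv : 0 < v) :
    ∃ m > 0, ∃ C ≥ 0, ∀ u, dist u (P.e₂ v) ≤ P.radius v →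
      P.lyapunovDeriv s v u ≤ -m * (u 0 - P.U₁) ^ 2 + C * |u 2| := by
  obtain ⟨L, hL⟩ := hP.k₃_lipschitz
  have hG := hP.continuous_baseGrowth
  have hH := hP.continuous_surplus (s := s)
  have hpow := hP.continuous_rpow
  obtain ⟨C, hC, hCb⟩ := exists_abs_le_closedBall (φ := fun u : Fin 3 → ℝ =>
    P.δ * u 1 * u 0 ^ P.δ * P.baseGrowth (u 0) + P.μ * u 0 ^ P.δ * P.surplus s (u 1))
    (by fun_prop) (P.e₂ v) (P.radius v)
  refine ⟨P.k₁ 0 * (P.μ * P.k₃ 0 * P.U₁ ^ (P.δ - 1)), mul_pos (hP.k₁_pos 0) (mul_pos hP.μk₃_pos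
    (Real.rpow_pos_of_pos hP.U₁_pos _)), L * C, by positivity, fun u hu => ?_⟩
  obtain ⟨h0, h1⟩ := half_le_of_dist_le hu
  have hu0 : 0 < u 0 := (half_pos hP.U₁_pos).trans_le h0
  have hu1 : 0 < u 1 := (half_pos hv).trans_le h1
  have hdef : P.deficit s v (u 1) = -P.surplus s (u 1) / u 1 := by
    rw [deficit, max_eq_left h1]
  have hk : |P.k₃ (u 2) - P.k₃ 0| ≤ L * |u 2| := by
    simpa [Real.dist_eq] using hL.dist_le_mul (u 2) 0
  -- The terms `baseGrowth * surplus` from the two equations cancel, since `deficit = -surplus / u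
  -- 1`. Apart from two dissipative terms, only a multiple of `k₃ (u 2) - k₃ 0` is left.
  have heq : P.lyapunovDeriv s v u = -(P.k₁ (u 1) * ((u 0 - P.U₁) * P.baseGrowth (u 0)))
      - P.δ / P.μ * u 1 * P.baseGrowth (u 0) ^ 2
      - (P.k₃ (u 2) - P.k₃ 0) * (P.δ * u 1 * u 0 ^ P.δ * P.baseGrowth (u 0)
        + P.μ * u 0 ^ P.δ * P.surplus s (u 1)) := by
    rw [lyapunovDeriv, hdef, hP.field_zero_eq hu0.le, field_one_eq_baseGrowth hu0.le]
    have := hP.μ_pos.ne'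
    field_simp
    ring
  have hx : P.μ * P.k₃ 0 * P.U₁ ^ (P.δ - 1) * (u 0 - P.U₁) ^ 2 ≤
      (u 0 - P.U₁) * P.baseGrowth (u 0) := by
    rw [hP.baseGrowth_eq hu0.le]
    have := mul_le_mul_of_nonneg_left (rpow_sub_rpow_mul_sub_ge hu0 hP.U₁_pos hP.one_le_δ)
      hP.μk₃_pos.le
    linarith
  have hx' := mul_le_mul (hP.k₁_strictMono.monotone hu1.le) hx (mul_nonneg (mul_nonneg
    hP.μk₃_pos.le (Real.rpow_nonneg hP.U₁_pos.le _)) (sq_nonneg _)) (hP.k₁_pos _).le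
  have hG2 : 0 ≤ P.δ / P.μ * u 1 * P.baseGrowth (u 0) ^ 2 := by
    have := hP.δ_pos
    have := hP.μ_pos
    positivity
  have herr : -((P.k₃ (u 2) - P.k₃ 0) * (P.δ * u 1 * u 0 ^ P.δ * P.baseGrowth (u 0)
      + P.μ * u 0 ^ P.δ * P.surplus s (u 1))) ≤ L * |u 2| * C := by
    refine (neg_le_abs _).trans ?_
    rw [abs_mul]
    exact mul_le_mul hk (hCb u hu) (abs_nonneg _) (by positivity)
  rw [heq]
  linarith

/-- The mixed term that detects deviations of the microbes from their equilibrium value. -/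
theorem Admissible.exists_cross_le (hP : P.Admissible) (hv : 0 < v) :
    ∃ C ≥ 0, ∀ u, dist u (P.e₂ v) ≤ P.radius v →
      P.field s u 0 * (u 1 - v) + (u 0 - P.U₁) * P.field s u 1 ≤
        P.surplus s (u 1) * (u 1 - v) + C * |u 0 - P.U₁| + C * |u 2| := by
  obtain ⟨L, hL⟩ := hP.k₃_lipschitz
  obtain ⟨B, hB0, -, hB⟩ := boundedLipschitzOn_rpow hP.one_le_δ (P.U₁ + P.radius v)
  have hk1 := hP.continuous_k₁
  have hk3 := hP.continuous_k₃
  have hpow := hP.continuous_rpow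
  obtain ⟨C₁, hC₁, hb₁⟩ := exists_abs_le_closedBall (φ := fun u : Fin 3 → ℝ =>
    P.μ * P.k₃ (u 2) * u 1 * u 0 ^ P.δ - P.k₄ * u 1 - P.k₁ (u 1) * (u 1 - v))
    (by fun_prop) (P.e₂ v) (P.radius v)
  obtain ⟨C₂, hC₂, hb₂⟩ := exists_abs_le_closedBall (φ := fun u : Fin 3 → ℝ =>
    -(P.δ / P.μ * u 1 * (u 1 - v))) (by fun_prop) (P.e₂ v) (P.radius v)
  obtain ⟨C₃, hC₃, hb₃⟩ := exists_abs_le_closedBall (φ := fun u : Fin 3 → ℝ =>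
    -(P.δ * u 1 * u 0 ^ P.δ * (u 1 - v))) (by fun_prop) (P.e₂ v) (P.radius v)
  have hμk := hP.μk₃_pos
  refine ⟨C₁ + P.μ * P.k₃ 0 * B * C₂ + L * C₃, by positivity, fun u hu => ?_⟩
  obtain ⟨h0, h1⟩ := half_le_of_dist_le hu
  have hU := hP.U₁_pos
  have hu0 : 0 < u 0 := (half_pos hU).trans_le h0
  have hk : |P.k₃ (u 2) - P.k₃ 0| ≤ L * |u 2| := by
    simpa [Real.dist_eq] using hL.dist_le_mul (u 2) 0
  have hG : |P.baseGrowth (u 0)| ≤ P.μ * P.k₃ 0 * B * |u 0 - P.U₁| := by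
    rw [hP.baseGrowth_eq hu0.le, abs_mul, abs_of_pos hμk, mul_assoc (P.μ * P.k₃ 0)]
    refine mul_le_mul_of_nonneg_left ?_ hμk.le
    have hup := (abs_le.1 ((abs_apply_sub_le_dist u (P.e₂ v) 0).trans hu)).2
    have e0 : P.e₂ v 0 = P.U₁ := rfl
    rw [e0] at hup
    exact hB (u 0) ⟨hu0.le, by linarith⟩ P.U₁ ⟨hU.le, by linarith [hP.radius_pos hv]⟩
  -- Every term but the first has a factor that is small with `u 0 - U₁` or with `u 2`.
  have heq : P.field s u 0 * (u 1 - v) + (u 0 - P.U₁) * P.field s u 1 =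
      P.surplus s (u 1) * (u 1 - v)
      + (u 0 - P.U₁) * (P.μ * P.k₃ (u 2) * u 1 * u 0 ^ P.δ - P.k₄ * u 1 - P.k₁ (u 1) * (u 1 - v))
      + P.baseGrowth (u 0) * (-(P.δ / P.μ * u 1 * (u 1 - v)))
      + (P.k₃ (u 2) - P.k₃ 0) * (-(P.δ * u 1 * u 0 ^ P.δ * (u 1 - v))) := by
    rw [hP.field_zero_eq hu0.le, field_one]
    ring
  have t1 : (u 0 - P.U₁) * (P.μ * P.k₃ (u 2) * u 1 * u 0 ^ P.δ - P.k₄ * u 1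
      - P.k₁ (u 1) * (u 1 - v)) ≤ |u 0 - P.U₁| * C₁ := by
    refine (le_abs_self _).trans ?_
    rw [abs_mul]
    gcongr
    exact hb₁ u hu
  have t2 : P.baseGrowth (u 0) * (-(P.δ / P.μ * u 1 * (u 1 - v))) ≤
      P.μ * P.k₃ 0 * B * |u 0 - P.U₁| * C₂ := by
    refine (le_abs_self _).trans ?_
    rw [abs_mul]
    exact mul_le_mul hG (hb₂ u hu) (abs_nonneg _) (by positivity)
  have t3 : (P.k₃ (u 2) - P.k₃ 0) * (-(P.δ * u 1 * u 0 ^ P.δ * (u 1 - v))) ≤ L * |u 2| * C₃ := by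
    refine (le_abs_self _).trans ?_
    rw [abs_mul]
    exact mul_le_mul hk (hb₃ u hu) (abs_nonneg _) (by positivity)
  have q1 : 0 ≤ L * C₃ * |u 0 - P.U₁| := by positivity
  have q2 : 0 ≤ (C₁ + P.μ * P.k₃ 0 * B * C₂) * |u 2| := by positivity
  rw [heq]
  linarith

/-- Gronwall for the square, because `u 2` may be negative; near `e₂` the microbes are positive, so
the decay rate is at least `k₂ 0`. -/
theorem Admissible.abs_charcoal_le (hP : P.Admissible) (hv : 0 < v) {T : ℝ}
    {S : Set (Fin 3 → ℝ)} {u : ℝ → Fin 3 → ℝ} (hu : IsSolutionOn (P.field s) S (Icc 0 T) u)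
    (hd : ∀ t ∈ Icc 0 T, dist (u t) (P.e₂ v) ≤ P.radius v) :
    ∀ t ∈ Icc 0 T, |u t 2| ≤ |u 0 2| * Real.exp (-P.k₂ 0 * t) := by
  intro t ht
  have h := le_mul_exp_of_hasDerivWithinAt_le (c := 2 * P.k₂ 0)
    (fun t ht => (hu.hasDerivWithinAt_apply ht 2).fun_pow 2) (fun t ht => ?_) t ht
  · rw [← sq_abs, ← sq_abs (u 0 2)] at h
    refine le_of_sq_le_sq (h.trans_eq ?_) (by positivity)
    rw [mul_pow, ← Real.exp_nat_mul]
    congr 2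
    push_cast
    ring
  · have hu1 : 0 ≤ u t 1 := (half_pos hv).le.trans (half_le_of_dist_le (hd t ht)).2
    have := mul_le_mul_of_nonneg_right (hP.k₂_strictMono.monotone hu1) (sq_nonneg (u t 2))
    rw [field_two]
    simp only [Nat.cast_ofNat, Nat.add_one_sub_one, pow_one]
    linarith

/-- Adding `C / k₂ 0` times the exponential bound on the charcoal to the Lyapunov function offsets
the error `C * |u 2|`. The sum is nonincreasing, and its initial smallness confines both potentials.
-/
theorem Admissible.stableWithin_e₂ (hP : P.Admissible) (hv : 0 < v) (hv' : P.surplus s v = 0)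
    (S : Set (Fin 3 → ℝ)) : StableWithin (P.field s) S (P.e₂ v) (P.radius v) := by
  obtain ⟨m, hm, C, hC, hdiss⟩ := hP.exists_lyapunovDeriv_le (s := s) hv
  have hκ := hP.k₂_pos 0
  intro ε hε
  obtain ⟨η₀, hη₀, H₀⟩ := exists_abs_sub_lt_of_potential_lt hP.continuous_baseGrowth
    (fun _ => hP.baseGrowth_pos) (fun _ => hP.baseGrowth_neg) hε
  obtain ⟨η₁, hη₁, H₁⟩ := exists_abs_sub_lt_of_potential_lt (hP.continuous_deficit (s := s) hv)
    (fun _ => hP.deficit_pos hv hv') (fun _ => hP.deficit_neg hv hv') hε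
  have hη : 0 < min η₀ η₁ := lt_min hη₀ hη₁
  have hev : ∀ᶠ x in 𝓝 (P.e₂ v), P.lyapunov s v x + C / P.k₂ 0 * |x 2| < min η₀ η₁ := by
    have hc : Continuous fun x : Fin 3 → ℝ => P.lyapunov s v x + C / P.k₂ 0 * |x 2| :=
      (hP.continuous_lyapunov hv).add (continuous_const.mul (continuous_apply 2).abs)
    refine hc.continuousAt.eventually (gt_mem_nhds ?_)
    have e2 : P.e₂ v 2 = 0 := rfl
    beta_reduce
    rwa [lyapunov_e₂, e2, abs_zero, mul_zero, add_zero]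
  obtain ⟨r, hr, H⟩ := Metric.eventually_nhds_iff.1 hev
  refine ⟨min r ε, lt_min hr hε, fun T hT u hu hd h0 t ht => ?_⟩
  have hz := hP.abs_charcoal_le hv hu hd
  have hz0 : |u 0 2| < ε := by
    have := (abs_apply_sub_le_dist (u 0) (P.e₂ v) 2).trans_lt (h0.trans_le (min_le_right _ _))
    have e2 : P.e₂ v 2 = 0 := rfl
    rwa [e2, sub_zero] at this
  have hanti : AntitoneOn (fun t => P.lyapunov s v (u t)
      + C / P.k₂ 0 * (|u 0 2| * Real.exp (-P.k₂ 0 * t))) (Icc 0 T) := by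
    refine antitoneOn_Icc_of_hasDerivWithinAt (fun t ht => (hP.hasDerivWithinAt_lyapunov hv hu ht).add
      ((((hasDerivWithinAt_id t (Icc 0 T)).const_mul (-P.k₂ 0)).exp.const_mul |u 0 2|).const_mul
        (C / P.k₂ 0))) fun t ht => ?_
    have ht' := Ioo_subset_Icc_self ht
    have h1 := hdiss (u t) (hd t ht')
    have h2 := mul_le_mul_of_nonneg_left (hz t ht') hC
    have h3 : 0 ≤ m * (u t 0 - P.U₁) ^ 2 := by positivity
    have h4 : C / P.k₂ 0 * (|u 0 2| * (Real.exp (-P.k₂ 0 * id t) * (-P.k₂ 0 * 1))) =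
        -(C * (|u 0 2| * Real.exp (-P.k₂ 0 * t))) := by
      simp only [id]
      field_simp
    rw [h4]
    linarith
  have hV : P.lyapunov s v (u t) < min η₀ η₁ := by
    have h1 := hanti ⟨le_rfl, hT⟩ ht ht.1
    simp only [mul_zero, Real.exp_zero, mul_one] at h1
    have h2 := H (h0.trans_le (min_le_left _ _))
    have h3 : 0 ≤ C / P.k₂ 0 * (|u 0 2| * Real.exp (-P.k₂ 0 * t)) := by positivity
    linarith
  have hp0 := potential_nonneg hP.continuous_baseGrowth (fun _ => hP.baseGrowth_pos)
    (fun _ => hP.baseGrowth_neg) (u t 0)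
  have hp1 := potential_nonneg (hP.continuous_deficit (s := s) hv) (fun _ => hP.deficit_pos hv hv')
    (fun _ => hP.deficit_neg hv hv') (u t 1)
  rw [lyapunov] at hV
  refine (dist_pi_lt_iff hε).2 fun i => ?_
  rw [Real.dist_eq]
  fin_cases i
  · exact H₀ (u t 0) (by linarith [min_le_left η₀ η₁])
  · exact H₁ (u t 1) (by linarith [min_le_right η₀ η₁])
  · have h1 : |u 0 2| * Real.exp (-P.k₂ 0 * t) ≤ |u 0 2| :=
      mul_le_of_le_one_right (abs_nonneg _) (Real.exp_le_one_iff.2 (by nlinarith [ht.1]))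
    have e2 : P.e₂ v 2 = 0 := rfl
    simp only [Fin.reduceFinMk, e2, sub_zero]
    exact ((hz t ht).trans h1).trans_lt hz0

/-- A solution cannot stay away from the equilibrium while its charcoal content is negligible. -/
theorem Admissible.exists_dist_lt_or_charcoal (hP : P.Admissible) (hv : 0 < v)
    (hv' : P.surplus s v = 0) {S : Set (Fin 3 → ℝ)} {r : ℝ} (hr : 0 < r) :
    ∃ ζ > 0, ∀ u, IsSolutionOn (P.field s) S (Ici 0) u →
      (∀ t ≥ 0, dist (u t) (P.e₂ v) ≤ P.radius v) → (∀ t ≥ 0, |u t 2| ≤ ζ) →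
      ∃ t ≥ 0, dist (u t) (P.e₂ v) < r := by
  obtain ⟨m, hm, C, hC, hdiss⟩ := hP.exists_lyapunovDeriv_le (s := s) hv
  obtain ⟨C', hC', hcross⟩ := hP.exists_cross_le (s := s) hv
  have hanti := hP.surplus_strictAnti (s := s)
  -- By monotonicity, `|surplus|` is at least `h` at distance `r` or more from `v`.
  set h := min (P.surplus s (v - r)) (-P.surplus s (v + r)) with hh
  have hpos : 0 < h := by
    have h1 := hanti (show v - r < v by linarith)
    have h2 := hanti (show v < v + r by linarith)
    exact lt_min (by linarith) (by linarith)
  have hfar : ∀ w, r ≤ |w - v| → P.surplus s w * (w - v) ≤ -(h * r) := by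
    intro w hw
    rcases le_abs.1 hw with h1 | h1
    · have h2 : h ≤ -P.surplus s w := (min_le_right _ _).trans
        (neg_le_neg (hanti.antitone (by linarith)))
      have := mul_le_mul h2 h1 hr.le (by linarith)
      linarith
    · have h2 : h ≤ P.surplus s w := (min_le_left _ _).trans (hanti.antitone (by linarith))
      have := mul_le_mul h2 h1 hr.le (by linarith)
      linarith
  -- The first summand absorbs `C' * |x|` at the price `h * r / 2`; the second yields `h * r` when
  -- `|x| ≥ r`. When `|w - v| ≥ r`, the surplus yields `h * r` instead.
  set N := (C' ^ 2 / (2 * (h * r)) + h / r) / m with hN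
  have hN0 : 0 ≤ N := by positivity
  have hNm : N * m = C' ^ 2 / (2 * (h * r)) + h / r := div_mul_cancel₀ _ hm.ne'
  have hneg : ∀ x w : ℝ, r ≤ |x| ∨ r ≤ |w - v| →
      -(N * m) * x ^ 2 + P.surplus s w * (w - v) + C' * |x| ≤ -(h * r / 2) := by
    intro x w hxw
    have hx2 : 0 ≤ x ^ 2 := sq_nonneg x
    have hhr : 0 < h * r := mul_pos hpos hr
    have h1 : C' * |x| ≤ h * r / 2 + C' ^ 2 / (2 * (h * r)) * x ^ 2 := by
      have h2 : 0 ≤ (h * r - C' * |x|) ^ 2 / (2 * (h * r)) := by positivity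
      have h3 : (h * r - C' * |x|) ^ 2 / (2 * (h * r)) =
          h * r / 2 - C' * |x| + C' ^ 2 / (2 * (h * r)) * |x| ^ 2 := by
        field_simp
        ring
      rw [h3, sq_abs] at h2
      linarith
    rw [hNm]
    rcases hxw with h2 | h2
    · have h3 : h * r ≤ h / r * x ^ 2 := by
        have h4 : r ^ 2 ≤ x ^ 2 := by rw [← sq_abs x]; gcongr
        calc h * r = h / r * r ^ 2 := by field_simp
          _ ≤ _ := by gcongr
      linarith [hP.surplus_mul_nonpos hv' w]
    · have h3 : 0 ≤ h / r * x ^ 2 := by positivity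
      linarith [hfar w h2]
  have hNC : 0 ≤ N * C + C' := by positivity
  set ζ := min (r / 2) (h * r / 4 / (N * C + C' + 1)) with hζ
  have hζ0 : 0 < ζ := lt_min (half_pos hr) (by positivity)
  have hζr : ζ < r := (min_le_left _ _).trans_lt (half_lt_self hr)
  have hζC : (N * C + C') * ζ ≤ h * r / 4 := by
    calc (N * C + C') * ζ ≤ (N * C + C' + 1) * (h * r / 4 / (N * C + C' + 1)) := by
          refine mul_le_mul (by linarith) (min_le_right _ _) hζ0.le (by linarith)
      _ = _ := by field_simp
  refine ⟨ζ, hζ0, fun u hu hd hz => ?_⟩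
  by_contra! hcon
  -- Away from `e₂` and with charcoal at most `ζ`, `Q` falls at rate at least `h * r / 4`: `hneg`
  -- gives `h * r / 2`, and the charcoal errors cost at most half of it. But `Q` is bounded below,
  -- which is violated by time `T`.
  set Q : ℝ → ℝ := fun t => N * P.lyapunov s v (u t) + (u t 0 - P.U₁) * (u t 1 - v) with hQ
  have e0 : P.e₂ v 0 = P.U₁ := rfl
  have e1 : P.e₂ v 1 = v := rfl
  have e2 : P.e₂ v 2 = 0 := rfl
  have hQlow : ∀ t ≥ 0, -(P.radius v ^ 2) ≤ Q t := by
    intro t ht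
    have a0 := (abs_apply_sub_le_dist (u t) (P.e₂ v) 0).trans (hd t ht)
    have a1 := (abs_apply_sub_le_dist (u t) (P.e₂ v) 1).trans (hd t ht)
    rw [e0] at a0
    rw [e1] at a1
    have a2 := mul_le_mul a0 a1 (abs_nonneg _) (hP.radius_pos hv).le
    rw [← abs_mul] at a2
    have a3 := (abs_le.1 a2).1
    have a4 := mul_nonneg hN0 (hP.lyapunov_nonneg hv hv' (u t))
    simp only [hQ]
    linarith
  set T := 4 * (Q 0 + P.radius v ^ 2 + 1) / (h * r) with hT
  have hT0 : 0 ≤ T := by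
    have := hQlow 0 le_rfl
    exact div_nonneg (by linarith) (by positivity)
  have huT := hu.mono (show Icc 0 T ⊆ Ici 0 from Icc_subset_Ici_self)
  have hantiQ : AntitoneOn (fun t => Q t + h * r / 4 * t) (Icc 0 T) := by
    refine antitoneOn_Icc_of_hasDerivWithinAt (fun t ht =>
      (((hP.hasDerivWithinAt_lyapunov hv huT ht).const_mul N).add
        (((huT.hasDerivWithinAt_apply ht 0).sub_const P.U₁).mul
          ((huT.hasDerivWithinAt_apply ht 1).sub_const v))).add
        ((hasDerivWithinAt_id t (Icc 0 T)).const_mul (h * r / 4))) fun t ht => ?_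
    have d := hd t ht.1.le
    have hz' := hz t ht.1.le
    have c1 := mul_le_mul_of_nonneg_left (hdiss (u t) d) hN0
    have c2 := hcross (u t) d
    have c3 := mul_le_mul_of_nonneg_left hz' hNC
    have c4 : r ≤ |u t 0 - P.U₁| ∨ r ≤ |u t 1 - v| := by
      by_contra! hlt
      refine absurd ((dist_pi_lt_iff hr).2 fun i => ?_) (not_lt.2 (hcon t ht.1.le))
      rw [Real.dist_eq]
      fin_cases i
      · exact hlt.1
      · exact hlt.2
      · simp only [Fin.reduceFinMk, e2, sub_zero]
        exact hz'.trans_lt hζr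
    have c5 := hneg _ _ c4
    simp only [mul_one]
    linarith
  have h1 := hantiQ ⟨le_rfl, hT0⟩ ⟨hT0, le_rfl⟩ hT0
  have h2 := hQlow T hT0
  have h3 : h * r / 4 * T = Q 0 + P.radius v ^ 2 + 1 := by
    rw [hT]; field_simp
  simp only [mul_zero, add_zero] at h1
  linarith

/-- After a waiting time the charcoal is below `ζ`, and the previous lemma applies to the restarted
solution. -/
theorem Admissible.exists_dist_e₂_lt (hP : P.Admissible) (hv : 0 < v)
    (hv' : P.surplus s v = 0) {S : Set (Fin 3 → ℝ)} {u : ℝ → Fin 3 → ℝ}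
    (hu : IsSolutionOn (P.field s) S (Ici 0) u)
    (hd : ∀ t ≥ 0, dist (u t) (P.e₂ v) ≤ P.radius v) {r : ℝ} (hr : 0 < r) :
    ∃ t ≥ 0, dist (u t) (P.e₂ v) < r := by
  obtain ⟨ζ, hζ, H⟩ := hP.exists_dist_lt_or_charcoal hv hv' (S := S) hr
  have hz : ∀ t ≥ 0, |u t 2| ≤ |u 0 2| * Real.exp (-P.k₂ 0 * t) := fun t ht =>
    hP.abs_charcoal_le hv (hu.mono Icc_subset_Ici_self) (fun τ hτ => hd τ hτ.1) t ⟨ht, le_rfl⟩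
  have hlim : Tendsto (fun t : ℝ => |u 0 2| * Real.exp (-P.k₂ 0 * t)) atTop (𝓝 0) := by
    have h1 : Tendsto (fun t : ℝ => -P.k₂ 0 * t) atTop atBot :=
      tendsto_id.const_mul_atTop_of_neg (neg_neg_of_pos (hP.k₂_pos 0))
    simpa using (Real.tendsto_exp_atBot.comp h1).const_mul |u 0 2|
  obtain ⟨a, ha⟩ := eventually_atTop.1 (hlim.eventually (gt_mem_nhds hζ))
  have ha0 : 0 ≤ max a 0 := le_max_right _ _
  obtain ⟨t, ht, htr⟩ := H (fun t => u (max a 0 + t)) (hu.shift ha0)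
    (fun t ht => hd _ (add_nonneg ha0 ht)) fun t ht => (hz _ (add_nonneg ha0 ht)).trans
      (ha _ ((le_max_left a 0).trans (le_add_of_nonneg_right ht))).le
  exact ⟨max a 0 + t, add_nonneg ha0 ht, htr⟩

theorem Admissible.asymptoticallyStable_univ_e₂ (hP : P.Admissible) (hs : P.threshold < s)
    (hv : P.MicrobeEq s v) : AsymptoticallyStable (P.field s) univ (P.e₂ v) := by
  have hv0 := hP.microbeEq_pos hs hv
  have hv' := microbeEq_iff.1 hv
  have hρ := hP.radius_pos hv0
  obtain ⟨K, hK⟩ := hP.exists_lipschitzOnWith_closedBall s (e := P.e₂ v) (ρ := P.radius v)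
    ((min_le_left _ _).trans (half_le_self hP.U₁_pos.le))
  exact ((hP.stableWithin_e₂ hv0 hv' univ).lyapunovStable_univ hρ hK).asymptoticallyStable hρ
    fun u hu hd r hr => hP.exists_dist_e₂_lt hv0 hv' hu hd hr

theorem Admissible.asymptoticallyStable_e₂ (hP : P.Admissible) (hs : P.threshold < s)
    (hv : P.MicrobeEq s v) : AsymptoticallyStable (P.field s) octant (P.e₂ v) :=
  (hP.asymptoticallyStable_univ_e₂ hs hv).of_univ
    fun _ hx => hP.exists_solution_octant (hP.threshold_pos.trans hs).le hx

end SoilModel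

/-! ### Linearization -/

/-- The product of a continuous function and a differentiable function that vanishes at `x`. -/
theorem HasFDerivAt.continuousAt_mul {E : Type*} [NormedAddCommGroup E] [NormedSpace ℝ E]
    {φ ψ : E → ℝ} {ψ' : E →L[ℝ] ℝ} {x : E} (hψ : HasFDerivAt ψ ψ' x) (hφ : ContinuousAt φ x)
    (h0 : ψ x = 0) : HasFDerivAt (fun y => φ y * ψ y) (φ x • ψ') x := by
  have h1 : HasFDerivAt (fun y => φ x * ψ y) (φ x • ψ') x := hψ.const_mul (φ x)
  have h2 : HasFDerivAt (fun y => (φ y - φ x) * ψ y) (0 : E →L[ℝ] ℝ) x := by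
    rw [hasFDerivAt_iff_isLittleO]
    have hO : ψ =O[𝓝 x] fun y => y - x := by
      simpa [h0] using hψ.isBigO_sub
    have ho : (fun y => φ y - φ x) =o[𝓝 x] fun _ => (1 : ℝ) := by
      rw [Asymptotics.isLittleO_one_iff]
      simpa using hφ.sub_const (φ x)
    have := ho.mul_isBigO hO.norm_right
    simpa [h0] using this.norm_right
  refine ((h1.add h2).congr_fderiv (add_zero _)).congr_of_eventuallyEq (.of_forall fun y => ?_)
  simp only [Pi.add_apply]
  ring

theorem jacobian_eq_of_hasFDerivAt {n : ℕ} {f : (Fin n → ℝ) → (Fin n → ℝ)} {x : Fin n → ℝ}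
    {M : Matrix (Fin n) (Fin n) ℝ} {L : Fin n → (Fin n → ℝ) →L[ℝ] ℝ}
    (h : ∀ i, HasFDerivAt (fun y => f y i) (L i) x)
    (hM : ∀ i w, L i w = (M.mulVec w) i) : DifferentiableAt ℝ f x ∧ jacobian f x = M := by
  have hf : HasFDerivAt f (ContinuousLinearMap.pi L) x := hasFDerivAt_pi.2 h
  refine ⟨hf.differentiableAt, ?_⟩
  rw [jacobian, hf.fderiv, ← LinearMap.toMatrix'_toLin' M]
  congr 1
  ext1 w
  ext i
  simp [hM]

theorem roots_three {p : Polynomial ℂ} {a b c : ℂ}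
    (h : p = (Polynomial.X - Polynomial.C a) * (Polynomial.X - Polynomial.C b) *
      (Polynomial.X - Polynomial.C c)) : p.roots = {a, b, c} := by
  have : p = (Multiset.map (fun a => Polynomial.X - Polynomial.C a) ({a, b, c} : Multiset ℂ)).prod := by
    simp [h, mul_assoc]
  rw [this, Polynomial.roots_multiset_prod_X_sub_C]

namespace SoilModel

variable {P : SoilModel} {s v : ℝ}

theorem hasFDerivAt_coord (i : Fin 3) (x : Fin 3 → ℝ) :
    HasFDerivAt (fun u : Fin 3 → ℝ => u i) (ContinuousLinearMap.proj (R := ℝ) i) x :=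
  hasFDerivAt_apply i x

/-- Only `k₁` needs a derivative: `k₂` and `k₃` multiply coordinates that vanish at `e₁`, so
`HasFDerivAt.continuousAt_mul` applies. -/
theorem Admissible.linearization_e₁ (hP : P.Admissible) (hk : DifferentiableAt ℝ P.k₁ 0) :
    DifferentiableAt ℝ (P.field s) (P.e₁ s) ∧
      jacobian (P.field s) (P.e₁ s) =
        !![-P.k₁ 0, -(deriv P.k₁ 0 / P.k₁ 0) * s - P.δ * P.k₃ 0 * (s / P.k₁ 0) ^ P.δ
              + P.η * P.k₄, 0;
           0, P.criticalEigenvalue s, 0;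
           0, 0, -P.k₂ 0] := by
  have e0 : P.e₁ s 0 = s / P.k₁ 0 := rfl
  have e1 : P.e₁ s 1 = 0 := rfl
  have e2 : P.e₁ s 2 = 0 := rfl
  have hc0 := hasFDerivAt_coord 0 (P.e₁ s)
  have hc1 := hasFDerivAt_coord 1 (P.e₁ s)
  have hc2 := hasFDerivAt_coord 2 (P.e₁ s)
  have hk1 : HasFDerivAt (fun u : Fin 3 → ℝ => P.k₁ (u 1))
      (deriv P.k₁ 0 • ContinuousLinearMap.proj (R := ℝ) 1) (P.e₁ s) :=
    HasDerivAt.comp_hasFDerivAt (P.e₁ s) (h₂ := P.k₁) (by rw [e1]; exact hk.hasDerivAt) hc1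
  have h3 := hP.continuous_k₃
  have h2 := hP.continuous_k₂
  have hpow := hP.continuous_rpow
  have hr : HasFDerivAt (fun u : Fin 3 → ℝ => P.k₃ (u 2) * u 0 ^ P.δ * u 1) _ (P.e₁ s) :=
    hc1.continuousAt_mul (φ := fun u : Fin 3 → ℝ => P.k₃ (u 2) * u 0 ^ P.δ)
      (Continuous.continuousAt (by fun_prop)) e1
  have hz : HasFDerivAt (fun u : Fin 3 → ℝ => -P.k₂ (u 1) * u 2) _ (P.e₁ s) :=
    hc2.continuousAt_mul (φ := fun u : Fin 3 → ℝ => -P.k₂ (u 1))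
      (Continuous.continuousAt (by fun_prop)) e2
  have hf0 := ((((hk1.mul hc0).neg).sub (hr.const_mul P.δ)).add
    (hc1.const_mul (P.η * P.k₄))).add_const s
  have hf1 := (hr.const_mul P.μ).sub (hc1.const_mul P.k₄)
  have g0 : HasFDerivAt (fun u => P.field s u 0) _ (P.e₁ s) :=
    hf0.congr_of_eventuallyEq (.of_forall fun u => by
      simp only [field_zero, Pi.add_apply, Pi.sub_apply, Pi.neg_apply, Pi.mul_apply]; ring)
  have g1 : HasFDerivAt (fun u => P.field s u 1) _ (P.e₁ s) :=
    hf1.congr_of_eventuallyEq (.of_forall fun u => by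
      simp only [field_one, Pi.sub_apply]; ring)
  have g2 : HasFDerivAt (fun u => P.field s u 2) _ (P.e₁ s) := hz
  refine jacobian_eq_of_hasFDerivAt (L := ![_, _, _])
    (Fin.forall_fin_succ.2 ⟨g0, Fin.forall_fin_two.2 ⟨g1, g2⟩⟩) ?_
  have hk0 := (hP.k₁_pos 0).ne'
  intro i w
  fin_cases i
  · simp [Matrix.mulVec, dotProduct, Fin.sum_univ_three, e0, e1, e2]
    field_simp
    ring
  · simp [Matrix.mulVec, dotProduct, Fin.sum_univ_three, e0, e1, e2, criticalEigenvalue]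
    ring
  · simp [Matrix.mulVec, dotProduct, Fin.sum_univ_three, e0, e1, e2]

/-- Here the microbes do not vanish, so `k₃` needs a derivative as well; `k₂` still multiplies the
vanishing charcoal. -/
theorem Admissible.linearization_e₂ (hP : P.Admissible) (hk : DifferentiableAt ℝ P.k₁ v)
    (hk' : DifferentiableAt ℝ P.k₃ 0) :
    DifferentiableAt ℝ (P.field s) (P.e₂ v) ∧
      jacobian (P.field s) (P.e₂ v) =
        !![P.A₁ v, P.A₂ v, -(P.δ / P.μ) * (deriv P.k₃ 0 / P.k₃ 0) * P.k₄ * v;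
           P.A₃ v, 0, deriv P.k₃ 0 / P.k₃ 0 * P.k₄ * v;
           0, 0, -P.k₂ v] := by
  have e0 : P.e₂ v 0 = P.U₁ := rfl
  have e1 : P.e₂ v 1 = v := rfl
  have e2 : P.e₂ v 2 = 0 := rfl
  have hU := hP.U₁_pos
  have hc0 := hasFDerivAt_coord 0 (P.e₂ v)
  have hc1 := hasFDerivAt_coord 1 (P.e₂ v)
  have hc2 := hasFDerivAt_coord 2 (P.e₂ v)
  have hk1 : HasFDerivAt (fun u : Fin 3 → ℝ => P.k₁ (u 1))
      (deriv P.k₁ v • ContinuousLinearMap.proj (R := ℝ) 1) (P.e₂ v) :=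
    HasDerivAt.comp_hasFDerivAt (P.e₂ v) (h₂ := P.k₁) (by rw [e1]; exact hk.hasDerivAt) hc1
  have hk3 : HasFDerivAt (fun u : Fin 3 → ℝ => P.k₃ (u 2))
      (deriv P.k₃ 0 • ContinuousLinearMap.proj (R := ℝ) 2) (P.e₂ v) :=
    HasDerivAt.comp_hasFDerivAt (P.e₂ v) (h₂ := P.k₃) (by rw [e2]; exact hk'.hasDerivAt) hc2
  have hpow : HasFDerivAt (fun u : Fin 3 → ℝ => u 0 ^ P.δ)
      ((P.δ * P.U₁ ^ (P.δ - 1)) • ContinuousLinearMap.proj (R := ℝ) 0) (P.e₂ v) :=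
    HasDerivAt.comp_hasFDerivAt (P.e₂ v) (h₂ := fun x : ℝ => x ^ P.δ)
      (by rw [e0]; exact Real.hasDerivAt_rpow_const (Or.inl hU.ne')) hc0
  have h2 := hP.continuous_k₂
  have hr := (hk3.mul hc1).mul hpow
  have hz : HasFDerivAt (fun u : Fin 3 → ℝ => -P.k₂ (u 1) * u 2) _ (P.e₂ v) :=
    hc2.continuousAt_mul (φ := fun u : Fin 3 → ℝ => -P.k₂ (u 1))
      (Continuous.continuousAt (by fun_prop)) e2
  have hf0 := ((((hk1.mul hc0).neg).sub (hr.const_mul P.δ)).add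
    (hc1.const_mul (P.η * P.k₄))).add_const s
  have hf1 := (hr.const_mul P.μ).sub (hc1.const_mul P.k₄)
  have g0 : HasFDerivAt (fun u => P.field s u 0) _ (P.e₂ v) :=
    hf0.congr_of_eventuallyEq (.of_forall fun u => by
      simp only [field_zero, Pi.add_apply, Pi.sub_apply, Pi.neg_apply, Pi.mul_apply]; ring)
  have g1 : HasFDerivAt (fun u => P.field s u 1) _ (P.e₂ v) :=
    hf1.congr_of_eventuallyEq (.of_forall fun u => by
      simp only [field_one, Pi.sub_apply, Pi.mul_apply]; ring)
  have g2 : HasFDerivAt (fun u => P.field s u 2) _ (P.e₂ v) := hz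
  refine jacobian_eq_of_hasFDerivAt (L := ![_, _, _])
    (Fin.forall_fin_succ.2 ⟨g0, Fin.forall_fin_two.2 ⟨g1, g2⟩⟩) ?_
  have hk30 := (hP.k₃_pos 0).ne'
  have hμ := hP.μ_pos.ne'
  intro i w
  fin_cases i
  · simp [Matrix.mulVec, dotProduct, Fin.sum_univ_three, e0, e1, e2, A₁, A₂, hP.U₁_rpow]
    field_simp
    ring
  · simp [Matrix.mulVec, dotProduct, Fin.sum_univ_three, e0, e1, e2, A₃, hP.U₁_rpow]
    field_simp
    ring
  · simp [Matrix.mulVec, dotProduct, Fin.sum_univ_three, e0, e1, e2]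

/-! ### Eigenvalues of the Jacobians -/

theorem complexEigenvalues_e₁ (a b c d : ℝ) :
    complexEigenvalues !![a, d, 0; 0, b, 0; 0, 0, c] = {(a : ℂ), (b : ℂ), (c : ℂ)} := by
  refine roots_three ?_
  rw [Matrix.charpoly, Matrix.det_fin_three]
  simp

theorem complexEigenvalues_e₂ (a b c d d' k : ℝ) {r : ℂ}
    (hr : r ^ 2 = ((a ^ 2 / 4 + b * c : ℝ) : ℂ)) :
    complexEigenvalues !![a, b, d; c, 0, d'; 0, 0, k] =
      {(k : ℂ), (a : ℂ) / 2 + r, (a : ℂ) / 2 - r} := by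
  refine roots_three ?_
  have h1 : (Polynomial.X - Polynomial.C ((a : ℂ) / 2 + r)) * (Polynomial.X - Polynomial.C ((a : ℂ) / 2 - r))
      = Polynomial.X ^ 2 - Polynomial.C (a : ℂ) * Polynomial.X
        - Polynomial.C (b : ℂ) * Polynomial.C (c : ℂ) := by
    have h2 : (b : ℂ) * c = r ^ 2 - (a : ℂ) ^ 2 / 4 := by
      rw [hr]; push_cast; ring
    rw [← Polynomial.C_mul, h2]
    have h3 : (a : ℂ) = a / 2 + a / 2 := by ring
    have h4 : r ^ 2 - (a : ℂ) ^ 2 / 4 = r * r - (a / 2) * (a / 2) := by ring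
    rw [h4]
    nth_rw 3 [h3]
    simp only [Polynomial.C_add, Polynomial.C_sub, Polynomial.C_mul]
    ring
  rw [mul_assoc, h1, Matrix.charpoly, Matrix.det_fin_three]
  simp
  ring

theorem sqrtDiscr_sq : P.sqrtDiscr v ^ 2 = ((P.A₁ v ^ 2 / 4 + P.A₂ v * P.A₃ v : ℝ) : ℂ) := by
  rw [sqrtDiscr, one_div]
  exact_mod_cast Complex.cpow_nat_inv_pow _ two_ne_zero

/-- Roots of `z² - a z + b` lie in the left half plane if `a < 0 < b`. -/
theorem re_neg_of_quadratic {a b : ℝ} (ha : a < 0) (hb : 0 < b) {z : ℂ}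
    (hz : z ^ 2 - a * z + b = 0) : z.re < 0 := by
  have hre := congrArg Complex.re hz
  have him := congrArg Complex.im hz
  simp [pow_two] at hre him
  by_contra! h
  -- If `z.re ≥ 0`, the imaginary part of the equation forces `z` to be real, and then all terms of
  -- its real part are nonnegative, with `b > 0`.
  have h1 : z.im * (2 * z.re - a) = 0 := by linarith
  rcases mul_eq_zero.1 h1 with h2 | h2
  · rw [h2] at hre
    nlinarith [mul_nonneg h h, mul_nonneg h (neg_pos.2 ha).le]
  · linarith

/-- The upper left block has trace `A₁ < 0` and determinant `-A₂ A₃`; the alternative in `h` is what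
makes `A₂` strictly negative and the determinant positive. -/
theorem Admissible.re_eigenvalues_neg (hP : P.Admissible) (hv : 0 < v)
    (h : P.η * P.μ < P.δ ∨ deriv P.k₁ v ≠ 0) :
    ∀ z ∈ ({((-P.k₂ v : ℝ) : ℂ), (P.A₁ v : ℂ) / 2 + P.sqrtDiscr v,
      (P.A₁ v : ℂ) / 2 - P.sqrtDiscr v} : Multiset ℂ), z.re < 0 := by
  have hU := hP.U₁_pos
  have hp : 0 < P.U₁ ^ (P.δ - 1) := Real.rpow_pos_of_pos hU _
  have hk1 := hP.k₁_pos v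
  have hk3 := hP.k₃_pos 0
  have hδ := hP.δ_pos
  have hμ := hP.μ_pos
  have hA1 : P.A₁ v < 0 := by
    have : 0 < P.δ ^ 2 * P.k₃ 0 * v * P.U₁ ^ (P.δ - 1) := by positivity
    rw [A₁]; linarith
  have hA3 : 0 < P.A₃ v := by rw [A₃]; positivity
  have hA2 : P.A₂ v < 0 := by
    have hd : 0 ≤ deriv P.k₁ v := hP.k₁_strictMono.monotone.deriv_nonneg
    have h1 := hP.slope_nonneg
    have h2 := mul_nonneg hd hU.le
    rw [A₂]
    rcases h with h | h
    · have : 0 < P.k₄ / P.μ * (P.δ - P.η * P.μ) :=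
        mul_pos (div_pos hP.k₄_pos hμ) (sub_pos.2 h)
      linarith
    · have := mul_pos (lt_of_le_of_ne hd h.symm) hU
      linarith
  have hb : 0 < -(P.A₂ v * P.A₃ v) := neg_pos.2 (mul_neg_of_neg_of_pos hA2 hA3)
  have hsq := sqrtDiscr_sq (P := P) (v := v)
  push_cast at hsq
  intro z hz
  simp only [Multiset.insert_eq_cons, Multiset.mem_cons, Multiset.mem_singleton] at hz
  rcases hz with rfl | rfl | rfl
  · rw [Complex.ofReal_re]; linarith [hP.k₂_pos v]
  · refine re_neg_of_quadratic hA1 hb ?_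
    push_cast
    linear_combination hsq
  · refine re_neg_of_quadratic hA1 hb ?_
    push_cast
    linear_combination hsq

end SoilModel

end

/-! ### The main theorem -/

theorem mainTheorem2 (P : SoilModel) (hP : P.Admissible) :
    -- the threshold is a bifurcation point
    IsBifurcationPoint P.field octant (Set.Ici 0) P.threshold ∧
    ∀ s : ℝ, 0 ≤ s →
      -- equilibria up to the threshold
      (s ≤ P.threshold → equilibria (P.field s) octant = {P.e₁ s}) ∧
      -- stability of the first equilibrium, by the sign of the critical eigenvalue
      (s < P.threshold → P.criticalEigenvalue s < 0 ∧
        AsymptoticallyStable (P.field s) octant (P.e₁ s) ∧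
        (0 < s → AsymptoticallyStable (P.field s) Set.univ (P.e₁ s))) ∧
      (P.threshold < s → 0 < P.criticalEigenvalue s ∧
        Unstable (P.field s) octant (P.e₁ s)) ∧
      -- linearization at the first equilibrium
      (DifferentiableAt ℝ P.k₁ 0 →
        DifferentiableAt ℝ (P.field s) (P.e₁ s) ∧
        jacobian (P.field s) (P.e₁ s) =
          !![-P.k₁ 0, -(deriv P.k₁ 0 / P.k₁ 0) * s - P.δ * P.k₃ 0 * (s / P.k₁ 0) ^ P.δ
                + P.η * P.k₄, 0;
             0, P.criticalEigenvalue s, 0;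
             0, 0, -P.k₂ 0] ∧
        complexEigenvalues (jacobian (P.field s) (P.e₁ s)) =
          {((-P.k₁ 0 : ℝ) : ℂ), (P.criticalEigenvalue s : ℂ), ((-P.k₂ 0 : ℝ) : ℂ)}) ∧
      -- the second equilibrium, above the threshold
      (P.threshold < s →
        (∃! v, P.MicrobeEq s v) ∧
        ∀ v, P.MicrobeEq s v →
          0 < v ∧
          equilibria (P.field s) octant = {P.e₁ s, P.e₂ v} ∧
          AsymptoticallyStable (P.field s) octant (P.e₂ v) ∧
          AsymptoticallyStable (P.field s) Set.univ (P.e₂ v) ∧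
          -- linearization at the second equilibrium
          (DifferentiableAt ℝ P.k₁ v → DifferentiableAt ℝ P.k₃ 0 →
            DifferentiableAt ℝ (P.field s) (P.e₂ v) ∧
            jacobian (P.field s) (P.e₂ v) =
              !![P.A₁ v, P.A₂ v, -(P.δ / P.μ) * (deriv P.k₃ 0 / P.k₃ 0) * P.k₄ * v;
                 P.A₃ v, 0, deriv P.k₃ 0 / P.k₃ 0 * P.k₄ * v;
                 0, 0, -P.k₂ v] ∧
            complexEigenvalues (jacobian (P.field s) (P.e₂ v)) =
              {((-P.k₂ v : ℝ) : ℂ), (P.A₁ v : ℂ) / 2 + P.sqrtDiscr v,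
                (P.A₁ v : ℂ) / 2 - P.sqrtDiscr v} ∧
            (P.η * P.μ < P.δ ∨ deriv P.k₁ v ≠ 0 →
              ∀ z ∈ complexEigenvalues (jacobian (P.field s) (P.e₂ v)), z.re < 0))) ∧
      -- exactly one equilibrium is stable
      (∃! e, e ∈ equilibria (P.field s) octant ∧ LyapunovStable (P.field s) octant e) := by
  refine ⟨hP.isBifurcationPoint, fun s hs => ⟨hP.equilibria_of_le hs, fun h =>
    ⟨hP.criticalEigenvalue_neg hs h, hP.asymptoticallyStable_e₁ hs h, fun hs0 =>
      hP.asymptoticallyStable_univ_e₁ hs0 h⟩, fun h => ⟨hP.criticalEigenvalue_pos h,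
      hP.unstable_e₁ h⟩, fun hk => ?_, fun h => ⟨hP.existsUnique_microbeEq h, fun v hv =>
      ⟨hP.microbeEq_pos h hv, hP.equilibria_of_lt h hv, hP.asymptoticallyStable_e₂ h hv,
        hP.asymptoticallyStable_univ_e₂ h hv, fun hk hk' => ?_⟩⟩, ?_⟩⟩
  · obtain ⟨hd, hJ⟩ := hP.linearization_e₁ (s := s) hk
    exact ⟨hd, hJ, by rw [hJ]; exact SoilModel.complexEigenvalues_e₁ _ _ _ _⟩
  · obtain ⟨hd, hJ⟩ := hP.linearization_e₂ (s := s) hk hk'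
    have hE := SoilModel.complexEigenvalues_e₂ (P.A₁ v) (P.A₂ v) (P.A₃ v)
      (-(P.δ / P.μ) * (deriv P.k₃ 0 / P.k₃ 0) * P.k₄ * v) (deriv P.k₃ 0 / P.k₃ 0 * P.k₄ * v)
      (-P.k₂ v) (SoilModel.sqrtDiscr_sq (P := P) (v := v))
    rw [hJ]
    refine ⟨hd, rfl, hE, fun h => ?_⟩
    rw [hE]
    exact hP.re_eigenvalues_neg (hP.microbeEq_pos ‹_› hv) h
  · rcases le_or_gt s P.threshold with h | h
    · have hst : LyapunovStable (P.field s) octant (P.e₁ s) := by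
        -- At the threshold itself the critical eigenvalue is zero, and the separate argument in the
        -- octant takes over.
        rcases h.eq_or_lt with rfl | h
        · exact hP.lyapunovStable_e₁_threshold
        · exact (hP.asymptoticallyStable_e₁ hs h).1
      rw [hP.equilibria_of_le hs h]
      exact ⟨P.e₁ s, ⟨mem_singleton _, hst⟩, fun e he => he.1⟩
    · obtain ⟨v, hv, -⟩ := hP.existsUnique_microbeEq h
      rw [hP.equilibria_of_lt h hv]
      refine ⟨P.e₂ v, ⟨by simp, (hP.asymptoticallyStable_e₂ h hv).1⟩, ?_⟩
      rintro e ⟨rfl | he, hst⟩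
      · exact absurd hst (hP.unstable_e₁ h).not_lyapunovStable
      · exact he
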